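/- Theorem. Let $I$ be a finite set. A forest on $I$ is a partition of $I$ together with a rooted tree on each part; its vertices which are not roots are its nodes, $N(F)$ is the set of nodes of $F$, $\pi(F)$ is the underlying partition, and $i\le_F j$ means that $i$ lies on the path from $j$ to the root of its tree. Write $F'\subseteq F$ if $\pi(F')$ is finer than $\pi(F)$ and, for $i,j$ in the same part of $\pi(F')$, one has $i\le_{F'}j$ if and only if $i\le_F j$; for $N\subseteq N(F)$ put $\gamma(F,N)=\sum_{F'\subseteq F,\,N(F')=N}F'$. Work with graded abelian groups and Koszul sign rules. Let $\mathsf F(I)$ be the free $\mathbb Z$-module on the oriented forests $o\otimes F$, where $o$ is a maximal exterior product of the set $N(F)\sqcup\{R\}$ with an auxiliary element $R$, modulo $(-o)\otimes F=-(o\otimes F)$, graded by $\deg(o\otimes F)=\#N(F)$, with coproduct $$\Delta(o\otimes F)=\sum_{N(F)=N_1\sqcup N_2}(o_1\otimes\gamma(F,N_1))\otimes(o_2\otimes\gamma(F,N_2)),$$ where $o=o_1\wedge r\wedge o_2$ modulo $R=R_1\wedge r\wedge R_2$, and with counit the projection to the component of degree zero (identified with $\mathbb Z$ by sending $R\otimes\widehat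 0$ to $1$, where $\widehat 0$ is the forest without nodes). Let $\mathsf F^*(I)$ be the graded dual, with the product and unit dual to $\Delta$ and to the counit, where $\langle f\otimes g,x\otimes y\rangle=(-1)^{\deg g\,\deg x}\langle f,x\rangle\langle g,y\rangle$ for homogeneous elements. Let $\mathsf M(I)$ be the graded-commutative associative unital $\mathbb Z$-algebra (in the strict sense: $ab=(-1)^{\deg a\,\deg b}ba$ for homogeneous $a,b$, and $a^2=0$ for $a$ of odd degree) with generators $\Omega_{i,j}$ of degree $1$ for $i\neq j$ in $I$ and relations $\Omega_{i,k}\Omega_{j,k}=0$ for pairwise different $i,j,k\in I$, and $\Omega_{i_0,i_1}\Omega_{i_1,i_2}\cdots\Omega_{i_n,i_0}=0$ for $n\ge1$ and pairwise different $i_0,\dots,i_n\in I$. That is, $\mathsf M(I)$ is the quotient by these relations of the exterior algebra over $\mathbb Z$ on the $\Omega_{i,j}$. Then there is an isomorphism of graded unital rings $\rho:\mathsf M(I)\to\mathsf F^*(I)$ such that, for all $i\ne j$ and $k\ne l$ in $I$, $\langle\rho(\Omega_{i,j}),(l\wedge R)\otimes F_{k,l}\rangle$ is $1$ if $(i,j)=(k,l)$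 and $0$ otherwise, where $F_{k,l}$ is the forest whose only node is $l$, attached to the root $k$. Moreover the monomials $m_F$, for $F$ a forest on $I$, form a basis of $\mathsf M(I)$ as a $\mathbb Z$-module, where $m_F$ is the product, in any chosen order, of the $\Omega_{i,j}$ over the edges of $F$, with $i$ the parent of $j$. -/

import Mathlib

open scoped TensorProduct

/-! ### Signs of words -/

section Words

variable {α β : Type*}

theorem pair_sublist_append {x y : α} {a b : List α} :
    [x, y].Sublist (a ++ b) ↔ [x, y].Sublist a ∨ [x, y].Sublist b ∨ (x ∈ a ∧ y ∈ b) := by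
  induction a with
  | nil => simp
  | cons c a ih =>
    rw [List.cons_append, List.sublist_cons_iff, List.sublist_cons_iff, ih]
    simp only [List.cons.injEq, List.mem_cons]
    constructor
    · rintro ((h | h | h) | ⟨r, ⟨rfl, rfl⟩, h⟩)
      · exact Or.inl (Or.inl h)
      · exact Or.inr (Or.inl h)
      · exact Or.inr (Or.inr ⟨Or.inr h.1, h.2⟩)
      · rcases List.mem_append.1 (List.singleton_sublist.1 h) with h | h
        · exact Or.inl (Or.inr ⟨[y], ⟨rfl, rfl⟩, List.singleton_sublist.2 h⟩)
        · exact Or.inr (Or.inr ⟨Or.inl rfl, h⟩)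
    · rintro ((h | ⟨r, ⟨rfl, rfl⟩, h⟩) | h | ⟨rfl | h1, h2⟩)
      · exact Or.inl (Or.inl h)
      · exact Or.inr ⟨[y], ⟨rfl, rfl⟩, List.singleton_sublist.2
          (List.mem_append.2 (Or.inl (List.singleton_sublist.1 h)))⟩
      · exact Or.inl (Or.inr (Or.inl h))
      · exact Or.inr ⟨[y], ⟨rfl, rfl⟩, List.singleton_sublist.2
          (List.mem_append.2 (Or.inr h2))⟩
      · exact Or.inl (Or.inr (Or.inr ⟨h1, h2⟩))

theorem pair_sublist_mem {x y : α} {l : List α} (h : [x, y].Sublist l) : x ∈ l ∧ y ∈ l :=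
  ⟨h.subset (by simp), h.subset (by simp)⟩

theorem pair_sublist_ne {x y : α} {l : List α} (hl : l.Nodup) (h : [x, y].Sublist l) :
    x ≠ y := by
  rintro rfl
  exact List.nodup_iff_sublist.1 hl x h

theorem pair_sublist_total {x y : α} {l : List α} (hx : x ∈ l) (hy : y ∈ l) (h : x ≠ y) :
    [x, y].Sublist l ∨ [y, x].Sublist l := by
  obtain ⟨a, b, rfl⟩ := List.append_of_mem hx
  rw [pair_sublist_append, pair_sublist_append]
  simp only [List.mem_append, List.mem_cons] at hy
  rcases hy with hy | hy | hy
  · exact Or.inr (Or.inr (Or.inr ⟨hy, by simp⟩))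
  · exact absurd hy.symm h
  · exact Or.inl (Or.inr (Or.inl (List.Sublist.cons_cons _ (List.singleton_sublist.2 hy))))

theorem pair_sublist_asymm {x y : α} {l : List α} (hl : l.Nodup) (h : [x, y].Sublist l) :
    ¬ [y, x].Sublist l := by
  intro h'
  obtain ⟨a, b, rfl⟩ := List.append_of_mem (pair_sublist_mem h).1
  have hne := pair_sublist_ne hl h
  rw [List.nodup_append] at hl
  obtain ⟨-, h2, h3⟩ := hl
  rw [List.nodup_cons] at h2
  have hb : y ∈ b := by
    rcases pair_sublist_append.1 h with h | h | h
    · exact absurd rfl (h3 x (pair_sublist_mem h).1 x (by simp))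
    · rcases List.mem_cons.1 (pair_sublist_mem h).2 with h | h
      · exact absurd h.symm hne
      · exact h
    · exact absurd rfl (h3 x h.1 x (by simp))
  rcases pair_sublist_append.1 h' with h | h | h
  · exact h3 x (pair_sublist_mem h).2 x (by simp) rfl
  · rw [List.sublist_cons_iff] at h
    rcases h with h | ⟨r, hr, -⟩
    · exact h2.1 (pair_sublist_mem h).2
    · exact hne (List.cons.inj hr).1.symm
  · exact h3 y h.1 y (by simp [hb]) rfl

variable [DecidableEq α] [DecidableEq β]

/-- The pairs `(x, y)` such that `x` comes before `y` in `l`, and after `y` in `l'`. -/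
def inversions (l l' : List α) : Finset (α × α) :=
  (l.toFinset ×ˢ l.toFinset).filter
    fun p => [p.1, p.2].Sublist l ∧ [p.2, p.1].Sublist l'

/-- For two words `l`, `l'` without repetition and with the same letters, the sign of the
permutation which takes `l` to `l'`, so that `⋀ l = relSign l l' • ⋀ l'` for the exterior
products. -/
def relSign (l l' : List α) : ℤ := (-1) ^ (inversions l l').card

theorem mem_inversions {l l' : List α} {p : α × α} :
    p ∈ inversions l l' ↔ [p.1, p.2].Sublist l ∧ [p.2, p.1].Sublist l' := by
  simp only [inversions, Finset.mem_filter, Finset.mem_product, List.mem_toFinset,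
    and_iff_right_iff_imp]
  exact fun h => pair_sublist_mem h.1

theorem relSign_mul_self (l l' : List α) : relSign l l' * relSign l l' = 1 := by
  rw [relSign, ← mul_pow]; simp

theorem relSign_self {l : List α} (hl : l.Nodup) : relSign l l = 1 := by
  have : inversions l l = ∅ := by
    ext p
    simp only [mem_inversions, Finset.notMem_empty, iff_false, not_and]
    exact fun h => pair_sublist_asymm hl h
  simp [relSign, this]

theorem relSign_comm (l l' : List α) : relSign l l' = relSign l' l := by
  unfold relSign
  congr 1
  refine Finset.card_bij (fun p _ => p.swap) ?_ ?_ ?_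
  · intro p hp
    rw [mem_inversions] at hp ⊢
    exact ⟨hp.2, hp.1⟩
  · intro p _ q _ h
    exact Prod.swap_injective h
  · intro p hp
    refine ⟨p.swap, ?_, Prod.swap_swap p⟩
    rw [mem_inversions] at hp ⊢
    exact ⟨hp.2, hp.1⟩

theorem relSign_trans {a b c : List α} (ha : a.Nodup) (hb : b.Nodup) (hc : c.Nodup)
    (hab : ∀ x, x ∈ a ↔ x ∈ b) (hbc : ∀ x, x ∈ b ↔ x ∈ c) :
    relSign a c = relSign a b * relSign b c := by
  have key : (inversions b c).card =
      ((a.toFinset ×ˢ a.toFinset).filter fun p => [p.1, p.2].Sublist a ∧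
        ¬ ([p.1, p.2].Sublist b ↔ [p.1, p.2].Sublist c)).card := by
    refine Finset.card_bij
      (fun p _ => if [p.1, p.2].Sublist a then p else p.swap) ?_ ?_ ?_
    · intro p hp
      rw [mem_inversions] at hp
      have hne := pair_sublist_ne hb hp.1
      have hm := pair_sublist_mem hp.1
      rw [← hab, ← hab] at hm
      have h1 := pair_sublist_asymm hb hp.1
      have h2 := pair_sublist_asymm hc hp.2
      split_ifs with h
      · simp [hm, h, hp.1, h2]
      · have := (pair_sublist_total hm.1 hm.2 hne).resolve_left h
        simp [hm, this, hp.2, h1]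
    · intro p hp q hq h
      rw [mem_inversions] at hp hq
      have h1 := pair_sublist_asymm hb hp.1
      split_ifs at h
      · exact h
      · subst h; exact absurd hq.1 h1
      · subst h; exact absurd hp.1 (pair_sublist_asymm hb hq.1)
      · exact Prod.swap_injective h
    · intro p hp
      simp only [Finset.mem_filter, Finset.mem_product, List.mem_toFinset] at hp
      obtain ⟨hm, h, hn⟩ := hp
      have hne := pair_sublist_ne ha h
      have hmb := hm
      rw [hab, hab] at hmb
      have hmc := hmb
      rw [hbc, hbc] at hmc
      have tb := pair_sublist_total hmb.1 hmb.2 hne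
      have tc := pair_sublist_total hmc.1 hmc.2 hne
      by_cases hpb : [p.1, p.2].Sublist b
      · refine ⟨p, mem_inversions.2 ⟨hpb, tc.resolve_left fun h => hn (by simp [h, hpb])⟩, ?_⟩
        simp [h]
      · refine ⟨p.swap, mem_inversions.2 ⟨tb.resolve_left hpb, ?_⟩, ?_⟩
        · by_contra h'
          exact hn ⟨fun h => absurd h hpb, fun h => absurd h h'⟩
        · simp [pair_sublist_asymm ha h]
  have e : ∀ d : List α, d.Nodup → (∀ x, x ∈ a ↔ x ∈ d) → inversions a d =
      (a.toFinset ×ˢ a.toFinset).filter fun p => [p.1, p.2].Sublist a ∧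
        ¬ [p.1, p.2].Sublist d := by
    intro d hd had
    ext p
    simp only [inversions, Finset.mem_filter, Finset.mem_product, List.mem_toFinset]
    refine and_congr_right fun hm => and_congr_right fun h => ?_
    have hne := pair_sublist_ne ha h
    rw [had, had] at hm
    exact ⟨fun h => pair_sublist_asymm hd h, (pair_sublist_total hm.1 hm.2 hne).resolve_left⟩
  unfold relSign
  rw [key, e b hb hab, e c hc fun x => (hab x).trans (hbc x)]
  simp only [Finset.filter_and, ← Finset.prod_const]
  simp only [← Finset.filter_and, Finset.prod_filter, ← Finset.prod_mul_distrib]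
  refine Finset.prod_congr rfl fun p _ => ?_
  by_cases h1 : [p.1, p.2].Sublist a <;> by_cases h2 : [p.1, p.2].Sublist b <;>
    by_cases h3 : [p.1, p.2].Sublist c <;> simp [h1, h2, h3]

theorem relSign_append {a b a' b' : List α} (ha : ∀ x, x ∈ a ↔ x ∈ a')
    (hb : ∀ x, x ∈ b ↔ x ∈ b') (hd : List.Disjoint a b) :
    relSign (a ++ b) (a' ++ b') = relSign a a' * relSign b b' := by
  have : inversions (a ++ b) (a' ++ b') = inversions a a' ∪ inversions b b' := by
    ext p
    simp only [mem_inversions, Finset.mem_union, pair_sublist_append]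
    constructor
    · rintro ⟨h | h | h, h' | h' | h'⟩
      · exact Or.inl ⟨h, h'⟩
      · exact absurd ((hb _).2 (pair_sublist_mem h').1) (hd (pair_sublist_mem h).2)
      · exact absurd ((hb _).2 h'.2) (hd (pair_sublist_mem h).1)
      · exact absurd (pair_sublist_mem h).1 (hd ((ha _).2 (pair_sublist_mem h').2))
      · exact Or.inr ⟨h, h'⟩
      · exact absurd (pair_sublist_mem h).2 (hd ((ha _).2 h'.1))
      · exact absurd h.2 (hd ((ha _).2 (pair_sublist_mem h').1))
      · exact absurd ((hb _).2 (pair_sublist_mem h').2) (hd h.1)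
      · exact absurd h.2 (hd ((ha _).2 h'.1))
    · rintro (⟨h, h'⟩ | ⟨h, h'⟩)
      · exact ⟨Or.inl h, Or.inl h'⟩
      · exact ⟨Or.inr (Or.inl h), Or.inr (Or.inl h')⟩
  rw [relSign, this, Finset.card_union_of_disjoint, pow_add]
  · rfl
  · rw [Finset.disjoint_left]
    intro p hp hq
    rw [mem_inversions] at hp hq
    exact hd (pair_sublist_mem hp.1).1 (pair_sublist_mem hq.1).1

theorem relSign_append_comm {a b : List α} (hab : (a ++ b).Nodup) :
    relSign (a ++ b) (b ++ a) = (-1) ^ (a.length * b.length) := by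
  have hd := List.disjoint_of_nodup_append hab
  have ha := hab.of_append_left
  have hb := hab.of_append_right
  have : inversions (a ++ b) (b ++ a) = a.toFinset ×ˢ b.toFinset := by
    ext p
    simp only [mem_inversions, Finset.mem_product, List.mem_toFinset, pair_sublist_append]
    constructor
    · rintro ⟨h | h | h, h' | h' | h'⟩
      · exact absurd (pair_sublist_mem h').1 (hd (pair_sublist_mem h).2)
      · exact absurd h' (pair_sublist_asymm ha h)
      · exact absurd h'.1 (hd (pair_sublist_mem h).2)
      · exact absurd h' (pair_sublist_asymm hb h)
      · exact absurd (pair_sublist_mem h).1 (hd (pair_sublist_mem h').2)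
      · exact absurd (pair_sublist_mem h).1 (hd h'.2)
      · exact h
      · exact h
      · exact h
    · exact fun h => ⟨Or.inr (Or.inr h), Or.inr (Or.inr h.symm)⟩
  rw [relSign, this, Finset.card_product, List.toFinset_card_of_nodup ha,
    List.toFinset_card_of_nodup hb]

theorem relSign_map {f : α → β} (hf : f.Injective) (l l' : List α) :
    relSign (l.map f) (l'.map f) = relSign l l' := by
  have hs : ∀ (x y : α) (m : List α), [f x, f y].Sublist (m.map f) ↔ [x, y].Sublist m := by
    intro x y m
    constructor
    · intro h
      obtain ⟨m', h1, h2⟩ := List.sublist_map_iff.1 h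
      have : [x, y] = m' := List.map_injective_iff.2 hf (by simpa using h2)
      rwa [this]
    · exact fun h => h.map f
  unfold relSign
  congr 1
  symm
  refine Finset.card_bij (fun p _ => (f p.1, f p.2)) ?_ ?_ ?_
  · intro p hp
    rw [mem_inversions] at hp ⊢
    exact ⟨(hs _ _ _).2 hp.1, (hs _ _ _).2 hp.2⟩
  · rintro ⟨p1, p2⟩ _ ⟨q1, q2⟩ _ h
    simp only [Prod.mk.injEq] at h ⊢
    exact ⟨hf h.1, hf h.2⟩
  · rintro ⟨q1, q2⟩ hq
    rw [mem_inversions] at hq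
    obtain ⟨h1, h2⟩ := pair_sublist_mem hq.1
    obtain ⟨x, -, rfl⟩ := List.mem_map.1 h1
    obtain ⟨y, -, rfl⟩ := List.mem_map.1 h2
    exact ⟨(x, y), mem_inversions.2 ⟨(hs _ _ _).1 hq.1, (hs _ _ _).1 hq.2⟩, rfl⟩

/-- Replacing every letter by a word of odd length does not change signs. -/
theorem relSign_flatMap {g : α → List β} (hodd : ∀ x, Odd (g x).length)
    (hn : ∀ x, (g x).Nodup) (hd : ∀ x y, x ≠ y → List.Disjoint (g x) (g y))
    {l l' : List α} (h : l.Perm l') (hl : l.Nodup) :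
    relSign (l.flatMap g) (l'.flatMap g) = relSign l l' := by
  have nd : ∀ m : List α, m.Nodup → (m.flatMap g).Nodup := fun m hm =>
    List.nodup_flatMap.2 ⟨fun x _ => hn x, hm.imp fun h => hd _ _ h⟩
  have mem : ∀ {m m' : List α}, m.Perm m' → ∀ y, y ∈ m.flatMap g ↔ y ∈ m'.flatMap g :=
    fun hm y => (hm.flatMap_right g).mem_iff
  induction h with
  | nil => rfl
  | @cons x l l' h ih =>
    have h1 : relSign (x :: l) (x :: l') = relSign [x] [x] * relSign l l' :=
      relSign_append (a := [x]) (a' := [x]) (fun _ => Iff.rfl) (fun _ => h.mem_iff)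
        (by simpa using (List.nodup_cons.1 hl).1)
    rw [h1, List.flatMap_cons, List.flatMap_cons, relSign_append (fun _ => Iff.rfl) (mem h),
      ih (List.nodup_cons.1 hl).2, relSign_self (hn x), relSign_self (List.nodup_singleton x)]
    have := nd _ hl
    rw [List.flatMap_cons] at this
    exact List.disjoint_of_nodup_append this
  | swap x y l =>
    have e : ∀ m : List α, y :: x :: m = ([y] ++ [x]) ++ m := fun _ => rfl
    have e' : ∀ m : List α, x :: y :: m = ([x] ++ [y]) ++ m := fun _ => rfl
    have hl1 := hl
    rw [e] at hl1
    have hl2 := nd _ hl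
    rw [List.flatMap_cons, List.flatMap_cons, ← List.append_assoc] at hl2
    have h1 : relSign (y :: x :: l) (x :: y :: l) = -1 := by
      rw [e, e', relSign_append (by simp [or_comm]) (fun _ => Iff.rfl)
        (List.disjoint_of_nodup_append hl1), relSign_append_comm hl1.of_append_left,
        relSign_self hl1.of_append_right]
      simp
    rw [h1]
    simp only [List.flatMap_cons]
    rw [← List.append_assoc, ← List.append_assoc,
      relSign_append (by simp [or_comm]) (fun _ => Iff.rfl)
        (List.disjoint_of_nodup_append hl2), relSign_append_comm hl2.of_append_left,
        relSign_self hl2.of_append_right, ((hodd y).mul (hodd x)).neg_one_pow, mul_one]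
  | @trans a b c h1 h2 ih1 ih2 =>
    have hb := h1.nodup_iff.1 hl
    have hc := h2.nodup_iff.1 hb
    rw [relSign_trans (nd _ hl) (nd _ hb) (nd _ hc) (mem h1) (mem h2), ih1 hl, ih2 hb,
      relSign_trans hl hb hc (fun _ => h1.mem_iff) (fun _ => h2.mem_iff)]

end Words

/-! ### Forests -/

/-- A forest of rooted trees on the vertex set `I`, seen as a directed graph in which every edge
`i ← j` points towards the root: every vertex `j` has at most one outgoing edge, which goes to its
parent `i` (roots have no parent), and there is no cycle. -/
@[ext]
structure RForest (I : Type*) where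
  parent : I → Option I
  acyclic : ∀ i, ¬ Relation.TransGen (fun i j => parent j = some i) i i

namespace RForest

variable {I : Type*}

/-- There is an edge `i ← j`. -/
def Edge (F : RForest I) (i j : I) : Prop := F.parent j = some i

/-- The ascendance relation `i ≤_F j`: `i` lies on the path from `j` to the root of its tree. -/
def Le (F : RForest I) (i j : I) : Prop := Relation.ReflTransGen F.Edge i j

/-- The partition `π(F)` of `I` into the vertex sets of the trees of `F`, that is, into
connected components. -/
def part (F : RForest I) : Setoid I := Relation.EqvGen.setoid F.Edge

/-- The relation `F' ⊆ F`: the partition `π(F')` is finer than `π(F)`, and each tree of `F'` is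
induced by `F` as a poset. -/
def Sub (F' F : RForest I) : Prop :=
  F'.part ≤ F.part ∧ ∀ i j, F'.part i j → (F'.Le i j ↔ F.Le i j)

variable [Fintype I]

/-- The nodes of a forest are the vertices which are not roots. -/
def nodes (F : RForest I) : Finset I := Finset.univ.filter fun j => (F.parent j).isSome

/-- The parent of a node. -/
def par (F : RForest I) (j : F.nodes) : I :=
  (F.parent j).get (Finset.mem_filter.1 j.2).2

theorem par_ne (F : RForest I) (j : F.nodes) : F.par j ≠ j := fun h =>
  F.acyclic j (Relation.TransGen.single
    ((Option.some_get (Finset.mem_filter.1 j.2).2).symm.trans (congrArg some h)))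

variable [DecidableEq I]

noncomputable instance : Fintype (RForest I) :=
  Fintype.ofInjective RForest.parent fun _ _ h => RForest.ext h

open Classical in
/-- The set `γ(F, N)` of the forests `F' ⊆ F` whose set of nodes is `N`. -/
noncomputable def gam (F : RForest I) (N : Finset I) : Finset (RForest I) :=
  Finset.univ.filter fun F' => F'.Sub F ∧ F'.nodes = N

theorem nodes_of_mem_gam {F F' : RForest I} {N : Finset I} (h : F' ∈ F.gam N) :
    F'.nodes = N := by
  classical
  exact (Finset.mem_filter.1 h).2.2

/-- The forest `F_{k,l}` with the only edge `k ← l`. -/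
def cherry (k l : I) (h : k ≠ l) : RForest I where
  parent j := if j = l then some k else none
  acyclic i hi := by
    have h1 : ∀ {a b : I}, Relation.TransGen
        (fun i j => (if j = l then some k else none) = some i) a b → a = k ∧ b = l := by
      intro a b hab
      have hs : ∀ {a b : I}, (if b = l then some k else none) = some a → a = k ∧ b = l := by
        intro a b hab
        split_ifs at hab with hb
        exact ⟨(Option.some.inj hab).symm, hb⟩
      induction hab with
      | single h => exact hs h
      | tail _ h ih => exact ⟨ih.1, (hs h).2⟩
    exact h ((h1 hi).1.symm.trans (h1 hi).2)

theorem mem_nodes_cherry {k l : I} (h : k ≠ l) (j : I) :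
    j ∈ (cherry k l h).nodes ↔ j = l := by
  simp [nodes, cherry]

end RForest

/-! ### Splitting exterior monomials -/

section Splitting

variable {I : Type*}

/-- Replace `R` by `R₁ ∧ r ∧ R₂` in an exterior monomial; here `R₁`, `r` and `R₂` are
`Sum.inr 0`, `Sum.inr 1` and `Sum.inr 2`. -/
def substWord (w : List (Option I)) : List (I ⊕ Fin 3) :=
  w.flatMap fun x => x.elim [Sum.inr 0, Sum.inr 1, Sum.inr 2] fun j => [Sum.inl j]

/-- The exterior monomial `o₁ ∧ r ∧ o₂`, where the auxiliary elements of `o₁` and `o₂` are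
`R₁` and `R₂`. -/
def joinWord (w₁ w₂ : List (Option I)) : List (I ⊕ Fin 3) :=
  w₁.map (fun x => x.elim (Sum.inr 0) Sum.inl) ++
    ([Sum.inr 1] ++ w₂.map (fun x => x.elim (Sum.inr 2) Sum.inl))

theorem mem_substWord {w : List (Option I)} (hw : none ∈ w) (x : I ⊕ Fin 3) :
    x ∈ substWord w ↔ ∀ j, x = Sum.inl j → some j ∈ w := by
  simp only [substWord, List.mem_flatMap]
  rcases x with j | k
  · constructor
    · rintro ⟨o, ho, hj⟩ i hi
      cases o with
      | none => simp at hj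
      | some l => simp at hj; rw [← Sum.inl.inj hi, hj]; exact ho
    · exact fun h => ⟨some j, h j rfl, by simp⟩
  · simp only [reduceCtorEq, false_implies, implies_true, iff_true]
    exact ⟨none, hw, by fin_cases k <;> simp⟩

theorem mem_joinWord {w₁ w₂ : List (Option I)} (h₁ : none ∈ w₁) (h₂ : none ∈ w₂)
    (x : I ⊕ Fin 3) :
    x ∈ joinWord w₁ w₂ ↔ ∀ j, x = Sum.inl j → some j ∈ w₁ ∨ some j ∈ w₂ := by
  rcases x with j | k
  · simp [joinWord, Option.exists]
  · fin_cases k <;> simp [joinWord, Option.exists, h₁, h₂]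

theorem nodup_substWord {w : List (Option I)} (hw : w.Nodup) : (substWord w).Nodup := by
  refine List.nodup_flatMap.2 ⟨fun x _ => by cases x <;> simp, hw.imp fun {a b} h => ?_⟩
  cases a <;> cases b <;> simp_all [Function.onFun, eq_comm]

theorem elim_injective (k : Fin 3) :
    Function.Injective fun x : Option I => x.elim (Sum.inr k) (Sum.inl : I → I ⊕ Fin 3) := by
  rintro (_ | a) (_ | b) h <;> simp_all

theorem joinWord_disjoint {w₁ w₂ : List (Option I)}
    (hd : ∀ j, some j ∈ w₁ → some j ∉ w₂) :
    List.Disjoint (w₁.map fun x => x.elim (Sum.inr 0) (Sum.inl : I → I ⊕ Fin 3))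
      ([Sum.inr 1] ++ w₂.map fun x => x.elim (Sum.inr 2) Sum.inl) := by
  intro x h h'
  simp only [List.mem_map, List.mem_append, List.mem_singleton] at h h'
  obtain ⟨_ | a, ha, rfl⟩ := h <;> rcases h' with h' | ⟨_ | b, hb, h'⟩ <;> simp at h'
  subst h'
  exact hd _ ha hb

theorem nodup_joinWord {w₁ w₂ : List (Option I)} (h₁ : w₁.Nodup) (h₂ : w₂.Nodup)
    (hd : ∀ j, some j ∈ w₁ → some j ∉ w₂) : (joinWord w₁ w₂).Nodup := by
  refine List.Nodup.append (h₁.map (elim_injective 0))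
    (List.Nodup.append (List.nodup_singleton _) (h₂.map (elim_injective 2)) ?_)
    (joinWord_disjoint hd)
  intro x h h'
  simp only [List.mem_map, List.mem_singleton] at h h'
  obtain ⟨_ | b, -, hb⟩ := h' <;> subst h <;> simp at hb

variable [DecidableEq I]

/-- The sign `ε` such that `o = ε • o₁ ∧ r ∧ o₂` modulo `R = R₁ ∧ r ∧ R₂`. -/
def splitSign (w w₁ w₂ : List (Option I)) : ℤ := relSign (substWord w) (joinWord w₁ w₂)

/-- The product `ε • o₁ ⊗ o₂` only depends on the exterior monomials `o`, `o₁` and `o₂` through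
their classes. -/
theorem splitSign_mul {w w' w₁ w₁' w₂ w₂' : List (Option I)}
    (hw : w.Nodup) (hw' : w'.Nodup) (h₁ : w₁.Nodup) (h₁' : w₁'.Nodup)
    (h₂ : w₂.Nodup) (h₂' : w₂'.Nodup) (n : none ∈ w) (n₁ : none ∈ w₁) (n₂ : none ∈ w₂)
    (e : ∀ x, x ∈ w ↔ x ∈ w') (e₁ : ∀ x, x ∈ w₁ ↔ x ∈ w₁') (e₂ : ∀ x, x ∈ w₂ ↔ x ∈ w₂')
    (hu : ∀ j, some j ∈ w ↔ some j ∈ w₁ ∨ some j ∈ w₂)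
    (hd : ∀ j, some j ∈ w₁ → some j ∉ w₂) :
    splitSign w w₁ w₂ * (relSign w₁ w₁' * relSign w₂ w₂') =
      relSign w w' * splitSign w' w₁' w₂' := by
  have hd' : ∀ j, some j ∈ w₁' → some j ∉ w₂' := by
    intro j; rw [← e₁, ← e₂]; exact hd j
  have E : relSign (substWord w) (substWord w') = relSign w w' := by
    refine relSign_flatMap (fun x => ?_) (fun x => ?_) (fun x y h => ?_)
      ((List.perm_ext_iff_of_nodup hw hw').2 e) hw
    · cases x <;> simp [Nat.odd_iff]
    · cases x <;> simp
    · cases x <;> cases y <;> simp_all [eq_comm]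
  have m₁ : ∀ (k : Fin 3) (v v' : List (Option I)), (∀ x, x ∈ v ↔ x ∈ v') → ∀ x,
      (x ∈ v.map fun x => x.elim (Sum.inr k) (Sum.inl : I → I ⊕ Fin 3)) ↔
        x ∈ v'.map fun x => x.elim (Sum.inr k) (Sum.inl : I → I ⊕ Fin 3) := by
    intro k v v' hv x
    simp only [List.mem_map, hv]
  have J : relSign (joinWord w₁ w₂) (joinWord w₁' w₂') = relSign w₁ w₁' * relSign w₂ w₂' := by
    unfold joinWord
    rw [relSign_append (m₁ 0 _ _ e₁) (by
        intro x; rw [List.mem_append, List.mem_append, m₁ 2 _ _ e₂]) (joinWord_disjoint hd),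
      relSign_append (fun _ => Iff.rfl) (m₁ 2 _ _ e₂), relSign_self (List.nodup_singleton _),
      one_mul, relSign_map (elim_injective 0), relSign_map (elim_injective 2)]
    intro x h h'
    simp only [List.mem_map, List.mem_singleton] at h h'
    obtain ⟨_ | b, -, hb⟩ := h' <;> subst h <;> simp at hb
  have n' := (e _).1 n
  have n₁' := (e₁ _).1 n₁
  have n₂' := (e₂ _).1 n₂
  have s : ∀ x, x ∈ substWord w ↔ x ∈ substWord w' := by
    intro x; simp only [mem_substWord n, mem_substWord n', e]
  have j : ∀ x, x ∈ joinWord w₁ w₂ ↔ x ∈ joinWord w₁' w₂' := by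
    intro x; simp only [mem_joinWord n₁ n₂, mem_joinWord n₁' n₂', e₁, e₂]
  have sj : ∀ x, x ∈ substWord w ↔ x ∈ joinWord w₁ w₂ := by
    intro x; simp only [mem_substWord n, mem_joinWord n₁ n₂, hu]
  have t₁ := relSign_trans (nodup_substWord hw) (nodup_joinWord h₁ h₂ hd)
    (nodup_joinWord h₁' h₂' hd') sj j
  have t₂ := relSign_trans (nodup_substWord hw) (nodup_substWord hw')
    (nodup_joinWord h₁' h₂' hd') s fun x => (s x).symm.trans ((sj x).trans (j x))
  unfold splitSign
  rw [← J, ← E, ← t₁, t₂]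

end Splitting

/-! ### The coalgebra of forests -/

section Coalgebra

variable {I : Type*} [Fintype I] [DecidableEq I]

/-- A forest `F` together with an exterior monomial `x₀ ∧ x₁ ∧ ⋯ ∧ xₙ` (stored as the word
`[x₀, …, xₙ]`) in which every element of `N(F) ⊔ {R}` appears once. The node `j` is written
`some j`, and the auxiliary element `R` is written `none`. -/
structure OrForest (I : Type*) [Fintype I] [DecidableEq I] where
  forest : RForest I
  word : List (Option I)
  nodup : word.Nodup
  none_mem : none ∈ word
  some_mem : ∀ j, some j ∈ word ↔ j ∈ forest.nodes

theorem OrForest.mem_iff {a b : OrForest I} (h : a.forest = b.forest) (x : Option I) :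
    x ∈ a.word ↔ x ∈ b.word := by
  cases x with
  | none => exact iff_of_true a.none_mem b.none_mem
  | some j => rw [a.some_mem, b.some_mem, h]

/-- The relations `o ⊗ F = ± (o' ⊗ F)`, for any two exterior monomials `o`, `o'` in the elements
of `N(F) ⊔ {R}`, where the sign is the one with `o = ± o'` in the exterior algebra. -/
noncomputable def orRel (I : Type*) [Fintype I] [DecidableEq I] : Submodule ℤ (OrForest I →₀ ℤ) :=
  Submodule.span ℤ {x | ∃ a b : OrForest I, a.forest = b.forest ∧
    x = Finsupp.single a 1 - relSign a.word b.word • Finsupp.single b 1}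

/-- The underlying module of the forest coalgebra `F(I)`: the free `ℤ`-module on the oriented
forests, modulo the relations which identify reversing the orientation with a change of sign. -/
abbrev ForMod (I : Type*) [Fintype I] [DecidableEq I] : Type _ := (OrForest I →₀ ℤ) ⧸ orRel I

/-- The class of an oriented forest in `F(I)`. -/
noncomputable def ForMod.of (a : OrForest I) : ForMod I := (orRel I).mkQ (Finsupp.single a 1)

theorem ForMod.of_eq {a b : OrForest I} (h : a.forest = b.forest) :
    ForMod.of a = relSign a.word b.word • ForMod.of b := by
  rw [ForMod.of, ForMod.of, ← map_smul, ← sub_eq_zero, ← map_sub]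
  exact (Submodule.Quotient.mk_eq_zero _).2 (Submodule.subset_span ⟨a, b, h, rfl⟩)

/-- A function on oriented forests which is compatible with the signs extends to a linear map
on `F(I)`. -/
noncomputable def ForMod.lift {M : Type*} [AddCommGroup M] (f : OrForest I → M)
    (hf : ∀ a b : OrForest I, a.forest = b.forest → f a = relSign a.word b.word • f b) :
    ForMod I →ₗ[ℤ] M :=
  (orRel I).liftQ (Finsupp.lift M ℤ (OrForest I) f) (by
    rw [orRel, Submodule.span_le]
    rintro _ ⟨a, b, h, rfl⟩
    rw [SetLike.mem_coe, LinearMap.mem_ker, map_sub, map_smul]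
    simp [hf a b h])

theorem ForMod.lift_of {M : Type*} [AddCommGroup M] (f : OrForest I → M)
    (hf : ∀ a b : OrForest I, a.forest = b.forest → f a = relSign a.word b.word • f b)
    (a : OrForest I) : ForMod.lift f hf (ForMod.of a) = f a := by
  simp [ForMod.lift, ForMod.of]

/-- The projection of `F(I)` onto the component of degree `n`, where `o ⊗ F` has as its degree the
number of nodes of `F`. -/
noncomputable def ForMod.proj (I : Type*) [Fintype I] [DecidableEq I] (n : ℕ) :
    ForMod I →ₗ[ℤ] ForMod I :=
  ForMod.lift (fun a => if a.forest.nodes.card = n then ForMod.of a else 0) (by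
    intro a b h
    simp only [h]
    split_ifs
    · exact ForMod.of_eq h
    · simp)

/-- Keep only the letters of the word which lie in `N ⊔ {R}`. -/
def restrictWord (w : List (Option I)) (N : Finset I) : List (Option I) :=
  w.filter fun x => ∀ j ∈ x, j ∈ N

/-- The exterior monomial of an oriented forest, restricted to the nodes of another forest. -/
def OrForest.restrict (a : OrForest I) (F' : RForest I) (h : F'.nodes ⊆ a.forest.nodes) :
    OrForest I where
  forest := F'
  word := restrictWord a.word F'.nodes
  nodup := a.nodup.filter _
  none_mem := by simp [restrictWord, a.none_mem]
  some_mem j := by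
    simp only [restrictWord, List.mem_filter, Option.mem_def, Option.some.injEq,
      forall_eq', decide_eq_true_eq, a.some_mem, and_iff_right_iff_imp]
    exact fun hj => h hj

/-- The value of the coproduct on an oriented forest `o ⊗ F`: the sum over the ordered partitions
`N(F) = N₁ ⊔ N₂`, over `F₁ ∈ γ(F, N₁)` and over `F₂ ∈ γ(F, N₂)`, of
`(o₁ ⊗ F₁) ⊗ (o₂ ⊗ F₂)`, where `o = o₁ ∧ r ∧ o₂` modulo `R = R₁ ∧ r ∧ R₂`. -/
noncomputable def comulAux (a : OrForest I) : ForMod I ⊗[ℤ] ForMod I :=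
  ∑ N : {N // N ∈ a.forest.nodes.powerset},
    ∑ F₁ : {F₁ // F₁ ∈ a.forest.gam N.1},
      ∑ F₂ : {F₂ // F₂ ∈ a.forest.gam (a.forest.nodes \ N.1)},
        splitSign a.word (restrictWord a.word F₁.1.nodes) (restrictWord a.word F₂.1.nodes) •
          (ForMod.of (a.restrict F₁.1 (by
              rw [RForest.nodes_of_mem_gam F₁.2]; exact Finset.mem_powerset.1 N.2)) ⊗ₜ[ℤ]
            ForMod.of (a.restrict F₂.1 (by
              rw [RForest.nodes_of_mem_gam F₂.2]; exact Finset.sdiff_subset)))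

/-- The coproduct of `F(I)`. -/
noncomputable def ForMod.comul (I : Type*) [Fintype I] [DecidableEq I] :
    ForMod I →ₗ[ℤ] ForMod I ⊗[ℤ] ForMod I :=
  ForMod.lift comulAux (by
    rintro ⟨F, w, hw, n, m⟩ ⟨F', w', hw', n', m'⟩ h
    obtain rfl : F = F' := h
    have e : ∀ x, x ∈ w ↔ x ∈ w' := by
      rintro (_ | x)
      · exact iff_of_true n n'
      · rw [m, m']
    unfold comulAux
    simp only [Finset.smul_sum]
    refine Finset.sum_congr rfl fun N _ => Finset.sum_congr rfl fun F₁ _ =>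
      Finset.sum_congr rfl fun F₂ _ => ?_
    have g₁ := RForest.nodes_of_mem_gam F₁.2
    have g₂ := RForest.nodes_of_mem_gam F₂.2
    have hN := Finset.mem_powerset.1 N.2
    generalize hA : OrForest.restrict (⟨F, w, hw, n, m⟩ : OrForest I) F₁.1 _ = A
    generalize hB : OrForest.restrict (⟨F, w, hw, n, m⟩ : OrForest I) F₂.1 _ = B
    generalize hA' : OrForest.restrict (⟨F, w', hw', n', m'⟩ : OrForest I) F₁.1 _ = A'
    generalize hB' : OrForest.restrict (⟨F, w', hw', n', m'⟩ : OrForest I) F₂.1 _ = B'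
    have fA : A.forest = F₁.1 := by rw [← hA]; rfl
    have fB : B.forest = F₂.1 := by rw [← hB]; rfl
    have fA' : A'.forest = F₁.1 := by rw [← hA']; rfl
    have fB' : B'.forest = F₂.1 := by rw [← hB']; rfl
    have wA : restrictWord w F₁.1.nodes = A.word := by rw [← hA]; rfl
    have wB : restrictWord w F₂.1.nodes = B.word := by rw [← hB]; rfl
    have wA' : restrictWord w' F₁.1.nodes = A'.word := by rw [← hA']; rfl
    have wB' : restrictWord w' F₂.1.nodes = B'.word := by rw [← hB']; rfl
    rw [wA, wB, wA', wB', ForMod.of_eq (fA.trans fA'.symm), ForMod.of_eq (fB.trans fB'.symm),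
      TensorProduct.smul_tmul_smul, smul_smul, smul_smul]
    congr 1
    refine splitSign_mul hw hw' A.nodup A'.nodup B.nodup B'.nodup n A.none_mem B.none_mem e
      (OrForest.mem_iff (fA.trans fA'.symm)) (OrForest.mem_iff (fB.trans fB'.symm)) ?_ ?_
    · intro j
      rw [A.some_mem, B.some_mem, m, fA, fB, g₁, g₂, Finset.mem_sdiff]
      have := @hN j
      tauto
    · intro j
      rw [A.some_mem, B.some_mem, fA, fB, g₁, g₂, Finset.mem_sdiff]
      tauto)

/-- The counit of `F(I)`: the projection onto the component of degree zero, which is generated by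
the forest without edges, oriented by `R`. -/
noncomputable def ForMod.counit (I : Type*) [Fintype I] [DecidableEq I] : ForMod I →ₗ[ℤ] ℤ :=
  ForMod.lift (fun a => if a.forest.nodes = ∅ then 1 else 0) (by
    intro a b h
    simp only [h]
    split_ifs with h0
    · have key : ∀ c : OrForest I, c.forest = b.forest → c.word = [none] := by
        intro c hc
        refine List.perm_singleton.1
          ((List.perm_ext_iff_of_nodup c.nodup (List.nodup_singleton _)).2 ?_)
        rintro (_ | j)
        · simp [c.none_mem]
        · simp [c.some_mem, hc, h0]
      rw [key a h, key b rfl, relSign_self (List.nodup_singleton _), one_smul]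
    · simp)

/-- The oriented forest `F_{k,l}`, with the orientation `l ∧ R`. -/
def orCherry (k l : I) (h : k ≠ l) : OrForest I where
  forest := RForest.cherry k l h
  word := [some l, none]
  nodup := by simp
  none_mem := by simp
  some_mem j := by simp [RForest.mem_nodes_cherry]

/-! ### The dual algebra -/

/-- The underlying module of the graded dual `F*(I)`. As `F(I)` has finite rank, it is the module
of all linear forms on `F(I)`. -/
def ForDual (I : Type*) [Fintype I] [DecidableEq I] : Type _ := ForMod I →ₗ[ℤ] ℤ

noncomputable instance : AddCommGroup (ForDual I) :=
  inferInstanceAs (AddCommGroup (ForMod I →ₗ[ℤ] ℤ))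

instance : FunLike (ForDual I) (ForMod I) ℤ :=
  inferInstanceAs (FunLike (ForMod I →ₗ[ℤ] ℤ) (ForMod I) ℤ)

/-- The component of degree `n` of `F*(I)`: the linear forms which vanish on the components of
`F(I)` of degree different from `n`. -/
def ForDual.IsHomogeneous (f : ForDual I) (n : ℕ) : Prop :=
  ∀ a : OrForest I, a.forest.nodes.card ≠ n → f (ForMod.of a) = 0

/-- The pairing `⟨f ⊗ g, x ⊗ y⟩` of `F*(I) ⊗ F*(I)` with `F(I) ⊗ F(I)`, with the Koszul sign rule:
it is `(-1) ^ (pq) f(x) g(y)` if `x` has degree `p` and `y` has degree `q`. The numbers of nodes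
are at most `#I`. -/
noncomputable def koszulPairing (f g : ForDual I) : ForMod I ⊗[ℤ] ForMod I →ₗ[ℤ] ℤ :=
  ∑ p ∈ Finset.range (Fintype.card I + 1), ∑ q ∈ Finset.range (Fintype.card I + 1),
    (-1 : ℤ) ^ (p * q) • (LinearMap.mul' ℤ ℤ ∘ₗ
      TensorProduct.map (LinearMap.comp f (ForMod.proj I p)) (LinearMap.comp g (ForMod.proj I q)))

/-- The product of `F*(I)` is dual to the coproduct of `F(I)`. -/
noncomputable instance : Mul (ForDual I) :=
  ⟨fun f g => koszulPairing f g ∘ₗ ForMod.comul I⟩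

/-- The unit of `F*(I)` is dual to the counit of `F(I)`. -/
noncomputable instance : One (ForDual I) := ⟨ForMod.counit I⟩

end Coalgebra

/-! ### The algebra `M(I)` -/

section Presentation

/-- The free graded-commutative algebra on generators `Ω_{i,j}` of degree one, for `i ≠ j` in `I`:
the exterior algebra over `ℤ` of the free module on these generators. -/
abbrev FreeOmega (I : Type*) : Type _ :=
  ExteriorAlgebra ℤ ({p : I × I // p.1 ≠ p.2} →₀ ℤ)

variable {I : Type*}

/-- The generator `Ω_{i,j}` of the free graded-commutative algebra. -/
noncomputable def freeOmega (i j : I) (h : i ≠ j) : FreeOmega I :=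
  ExteriorAlgebra.ι ℤ (Finsupp.single ⟨(i, j), h⟩ 1)

/-- The relations of `M(I)`. In the second one, the vertices `i₀, …, iₙ` with `n ≥ 1` are pairwise
different, and the indices are taken modulo `n + 1`. -/
inductive OmegaRel (I : Type*) : FreeOmega I → FreeOmega I → Prop
  | fork (i j k : I) (hij : i ≠ j) (hik : i ≠ k) (hjk : j ≠ k) :
      OmegaRel I (freeOmega i k hik * freeOmega j k hjk) 0
  | cycle (n : ℕ) (hn : 1 ≤ n) (i : Fin (n + 1) → I) (hi : Function.Injective i)
      (h : ∀ k, i k ≠ i (k + 1)) :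
      OmegaRel I (List.ofFn fun k => freeOmega (i k) (i (k + 1)) (h k)).prod 0

/-- The algebra `M(I)`. -/
abbrev OmegaAlg (I : Type*) : Type _ := RingQuot (OmegaRel I)

/-- The generator `Ω_{i,j}` of `M(I)`. -/
noncomputable def omegaGen (i j : I) (h : i ≠ j) : OmegaAlg I :=
  RingQuot.mkAlgHom ℤ (OmegaRel I) (freeOmega i j h)

/-- The component of degree `n` of `M(I)`, spanned by the products of `n` generators. -/
noncomputable def OmegaAlg.degree (I : Type*) (n : ℕ) : Submodule ℤ (OmegaAlg I) :=
  Submodule.span ℤ {x | ∃ i j : I, ∃ h : i ≠ j, x = omegaGen i j h} ^ n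

/-- The monomial `m_F`: the product of the generators `Ω_{i,j}` over the edges `i ← j` of `F`,
where `l` lists the nodes `j` of `F`. -/
noncomputable def forestMonomial [Fintype I] (F : RForest I) (l : List F.nodes) : OmegaAlg I :=
  (l.map fun j => omegaGen (F.par j) j (F.par_ne j)).prod

end Presentation

/-! ### Ascendance in forests -/

namespace RForest

section Ascendance

variable {I : Type*} {F G : RForest I} {i j k : I}

/-! A list `s` of arrows `i ← j` gives a linear form `Arrow.dual s`. It is nonzero on `o ⊗ F`
exactly when the targets of `s` are pairwise different, are the nodes of `F`, and every arrow is an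
ascent `i ≤_F j`; its value is then a sign. These forms are the images of the monomials in the
`Ω_{i,j}`.

The core is `Arrow.dual_append`: the product of two such forms is the form of the concatenated list.
For arrows with different targets which are ascents of `F`, exactly one subforest of `F` is
compatible with them (`Arrow.existsUnique_sub`). Indeed the arrows are the edges of a forest `G`,
the partition of the subforest must be the one of `G`, and a subforest is determined by its
partition since its order is induced by `F`. So a single term of the coproduct survives, and its
orientation sign cancels the Koszul sign (`splitSign_orWord`).

The relations of `M(I)` hold for these forms: two arrows with the same target repeat a node, and a
cycle of ascents contradicts antisymmetry. Hence there is a morphism from `M(I)`. In `M(I)`, a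
product of generators either vanishes by the relations or is a forest monomial up to sign, so the
forest monomials span (`span_forestMonomial`). In the dual, the form of the edges of `F` is nonzero
at `G` only if the nodes agree and `≤_G` extends `≤_F`. If forests are sorted by their number of
comparable pairs, the matrix of values is unitriangular, and these forms are a basis over `ℤ`
(`ForDual.eval_unitriangular`). A spanning family which is sent to a basis is itself a basis, and
the morphism is an isomorphism.

The ring axioms of the dual have the same source: the forms `Arrow.dual s` span and multiply like
lists, so coassociativity is never checked on forests. -/

theorem Edge.le (h : F.Edge i j) : F.Le i j := Relation.ReflTransGen.single h

theorem Edge.unique (h : F.Edge i j) (h' : F.Edge k j) : i = k :=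
  Option.some.inj (h.symm.trans h')

theorem Edge.ne (h : F.Edge i j) : i ≠ j := by
  rintro rfl
  exact F.acyclic i (Relation.TransGen.single h)

theorem Le.refl (F : RForest I) (i : I) : F.Le i i := Relation.ReflTransGen.refl

theorem Le.trans (h : F.Le i j) (h' : F.Le j k) : F.Le i k := Relation.ReflTransGen.trans h h'

theorem Le.antisymm (h : F.Le i j) (h' : F.Le j i) : i = j := by
  rcases Relation.reflTransGen_iff_eq_or_transGen.1 h with h1 | h1
  · exact h1.symm
  · exact absurd (h1.trans_left h') (F.acyclic i)

theorem Le.eq_or_edge (h : F.Le i j) : i = j ∨ ∃ k, F.Edge k j ∧ F.Le i k := by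
  rcases Relation.ReflTransGen.cases_tail h with h | ⟨k, h, h'⟩
  · exact Or.inl h.symm
  · exact Or.inr ⟨k, h', h⟩

theorem Le.le_of_edge (h : F.Le i j) (hij : i ≠ j) (h' : F.Edge k j) : F.Le i k := by
  obtain ⟨l, hl, hil⟩ := h.eq_or_edge.resolve_left hij
  rwa [h'.unique hl]

/-- The ancestors of a vertex form a chain, because the path towards the root is forced at each
step. -/
theorem Le.total (h : F.Le i j) (h' : F.Le k j) : F.Le i k ∨ F.Le k i := by
  induction h with
  | refl => exact Or.inr h'
  | tail hb hc ih =>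
    rcases h'.eq_or_edge with rfl | ⟨d, hd, hkd⟩
    · exact Or.inl (hb.tail hc)
    · obtain rfl := hd.unique hc
      exact ih hkd

theorem transGen_of_le_of_ne (h : F.Le i j) (hij : i ≠ j) : Relation.TransGen F.Edge i j :=
  (Relation.reflTransGen_iff_eq_or_transGen.1 h).resolve_left (Ne.symm hij)

theorem wellFounded [Finite I] (F : RForest I) : WellFounded (Relation.TransGen F.Edge) :=
  haveI : Std.Irrefl (Relation.TransGen F.Edge) := ⟨F.acyclic⟩
  Finite.wellFounded_of_trans_of_irrefl _

/-- The parent is the greatest proper ancestor. Edges are thereby recovered from the order, so that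
a forest is determined by its ascendance relation. -/
theorem edge_iff : F.Edge i j ↔ F.Le i j ∧ i ≠ j ∧ ∀ k, F.Le k j → k ≠ j → F.Le k i := by
  constructor
  · exact fun h => ⟨h.le, h.ne, fun k hk hkj => hk.le_of_edge hkj h⟩
  · rintro ⟨h, hij, hm⟩
    obtain ⟨k, hk, hik⟩ := h.eq_or_edge.resolve_left hij
    rwa [hik.antisymm (hm k hk.le hk.ne)]

theorem ext_of_edge (h : ∀ i j, F.Edge i j ↔ G.Edge i j) : F = G :=
  RForest.ext (funext fun j => Option.ext fun i => h i j)

theorem ext_of_le (h : ∀ i j, F.Le i j ↔ G.Le i j) : F = G :=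
  ext_of_edge fun i j => by simp only [edge_iff, h]

theorem le_of_edge_le (h : ∀ i j, G.Edge i j → F.Le i j) : ∀ {i j}, G.Le i j → F.Le i j := by
  intro i j hij
  induction hij with
  | refl => exact Le.refl F i
  | tail _ hc ih => exact ih.trans (h _ _ hc)

theorem Edge.part (h : F.Edge i j) : F.part i j := Relation.EqvGen.rel _ _ h

theorem Le.part (h : F.Le i j) : F.part i j := by
  induction h with
  | refl => exact F.part.refl _
  | tail _ hc ih => exact F.part.trans ih hc.part

theorem part_le_of_edge {r : Setoid I} (h : ∀ i j, F.Edge i j → r i j) : F.part ≤ r := by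
  intro i j hij
  induction hij with
  | rel _ _ hab => exact h _ _ hab
  | refl _ => exact r.refl _
  | symm _ _ _ ih => exact r.symm ih
  | trans _ _ _ _ _ ih ih' => exact r.trans ih ih'

/-! ### Roots -/

theorem exists_root [Finite I] (F : RForest I) (j : I) : ∃ r, F.parent r = none ∧ F.Le r j := by
  induction j using F.wellFounded.induction with
  | _ j ih =>
    rcases hj : F.parent j with _ | i
    · exact ⟨j, hj, Le.refl F j⟩
    · have hij : F.Edge i j := hj
      obtain ⟨r, hr, hri⟩ := ih i (Relation.TransGen.single hij)
      exact ⟨r, hr, hri.trans hij.le⟩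

theorem Le.eq_of_root (h : F.Le i j) (hj : F.parent j = none) : i = j := by
  refine h.eq_or_edge.resolve_right ?_
  rintro ⟨k, hk, -⟩
  rw [Edge, hj] at hk
  cases hk

theorem root_unique {r s : I} (hr : F.parent r = none) (hs : F.parent s = none)
    (h : F.Le r j) (h' : F.Le s j) : r = s :=
  (h.total h').elim (fun h => h.eq_of_root hs) (fun h => (h.eq_of_root hr).symm)

/-- It suffices to cross one edge: a root which is an ancestor of the lower end differs from that
end, which has a parent, and so is an ancestor of the upper end. -/
theorem root_le_iff {r : I} (hr : F.parent r = none) (h : F.part i j) :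
    F.Le r i ↔ F.Le r j := by
  induction h with
  | rel a b hab =>
    refine ⟨fun h => h.trans hab.le, fun h => h.le_of_edge ?_ hab⟩
    rintro rfl
    exact absurd (hr.symm.trans hab) (by simp)
  | refl _ => exact Iff.rfl
  | symm _ _ _ ih => exact ih.symm
  | trans _ _ _ _ _ ih ih' => exact ih.trans ih'

/-! ### Construction of forests -/

theorem exists_edge_iff (R : I → I → Prop) (hu : ∀ i k j, R i j → R k j → i = k)
    (ha : ∀ i, ¬ Relation.TransGen R i i) : ∃ F : RForest I, ∀ i j, F.Edge i j ↔ R i j := by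
  classical
  let p : I → Option I := fun j => if h : ∃ i, R i j then some h.choose else none
  have hp : ∀ i j, p j = some i ↔ R i j := by
    intro i j
    by_cases h : ∃ i, R i j
    · simp only [p, dif_pos h, Option.some.injEq]
      exact ⟨fun e => e ▸ h.choose_spec, fun e => hu _ _ _ h.choose_spec e⟩
    · simp only [p, dif_neg h, reduceCtorEq, false_iff]
      exact fun e => h ⟨i, e⟩
  exact ⟨⟨p, by simpa only [hp] using ha⟩, hp⟩

/-- Follow the path from `j` towards the root and stop at the first vertex which satisfies `P`. -/
theorem exists_greatest {P : I → Prop} (h : F.Le i j) (hi : P i) :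
    ∃ m, P m ∧ F.Le m j ∧ ∀ k, F.Le k j → P k → F.Le k m := by
  induction h with
  | refl => exact ⟨i, hi, Le.refl F i, fun k hk _ => hk⟩
  | @tail b c _ hc ih =>
    by_cases h : P c
    · exact ⟨c, h, Le.refl F c, fun k hk _ => hk⟩
    · obtain ⟨m, hm, hmb, hmax⟩ := ih
      refine ⟨m, hm, hmb.trans hc.le, fun k hk hPk => hmax k (hk.le_of_edge ?_ hc) hPk⟩
      rintro rfl
      exact h hPk

/-- The forest whose ascendance relation is the one of `F`, restricted to the classes of `r`. -/
theorem exists_le_iff [Finite I] (F : RForest I) (r : Setoid I) :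
    ∃ H : RForest I, ∀ i j, H.Le i j ↔ F.Le i j ∧ r i j := by
  -- `R i j` says that `i` is the greatest proper ancestor of `j` within the class of `j`, on the
  -- model of `edge_iff`.
  let R : I → I → Prop := fun i j => (F.Le i j ∧ r i j) ∧ i ≠ j ∧
    ∀ k, F.Le k j → r k j → k ≠ j → F.Le k i
  have hR : ∀ {i j}, R i j → Relation.TransGen F.Edge i j :=
    fun h => transGen_of_le_of_ne h.1.1 h.2.1
  obtain ⟨H, hH⟩ := exists_edge_iff R
    (fun i k j h h' => (h'.2.2 i h.1.1 h.1.2 h.2.1).antisymm (h.2.2 k h'.1.1 h'.1.2 h'.2.1))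
    (fun i h => F.acyclic i (by
      have : ∀ {a b}, Relation.TransGen R a b → Relation.TransGen F.Edge a b := by
        intro a b hab
        induction hab with
        | single h => exact hR h
        | tail _ h ih => exact ih.trans (hR h)
      exact this h))
  refine ⟨H, fun i j => ⟨fun h => ?_, ?_⟩⟩
  · induction h with
    | refl => exact ⟨Le.refl F i, r.refl i⟩
    | tail _ hc ih =>
      have := ((hH _ _).1 hc).1
      exact ⟨ih.1.trans this.1, r.trans ih.2 this.2⟩
  · induction j using F.wellFounded.induction with
    | _ j ih =>
      rintro ⟨hij, hr⟩
      by_cases e : i = j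
      · exact e ▸ Le.refl H i
      · obtain ⟨c, hc, hic⟩ := hij.eq_or_edge.resolve_left e
        -- Starting the search at the parent `c` excludes `j` itself. The vertex `m` is the parent
        -- of `j` in `H`, and the induction continues from it.
        obtain ⟨m, hm, hmc, hmax⟩ := exists_greatest (P := fun m => r m j) hic hr
        have hmj : m ≠ j := by
          rintro rfl
          exact hc.ne (hc.le.antisymm hmc)
        have hRm : R m j := ⟨⟨hmc.trans hc.le, hm⟩, hmj,
          fun k hk hrk hkj => hmax k (hk.le_of_edge hkj hc) hrk⟩
        exact (ih m (hR hRm) ⟨hmax i hic hr, r.trans hr (r.symm hm)⟩).trans ((hH _ _).2 hRm).le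

end Ascendance

/-! ### Subforests with prescribed nodes -/

section Subforests

variable {I : Type*} [Fintype I] {F G F₁ F₂ : RForest I}

theorem mem_nodes {j : I} : j ∈ F.nodes ↔ ∃ i, F.Edge i j := by
  simp [nodes, Edge, Option.isSome_iff_exists]

theorem parent_eq_none_iff {j : I} : F.parent j = none ↔ j ∉ F.nodes := by
  simp [nodes]

theorem edge_par (F : RForest I) (j : F.nodes) : F.Edge (F.par j) j :=
  (Option.some_get (Finset.mem_filter.1 j.2).2).symm

/-- Both forests have the same roots. If `i` and `j` share a tree of `F₁`, their roots in `G` are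
roots of that tree too, hence coincide. -/
theorem part_eq_of_nodes_eq (hn : F₁.nodes = G.nodes) (h : ∀ i j, G.Edge i j → F₁.Le i j) :
    F₁.part = G.part := by
  refine le_antisymm (fun i j hij => ?_) (part_le_of_edge fun i j hij => (h i j hij).part)
  obtain ⟨r, hr, hri⟩ := G.exists_root i
  obtain ⟨s, hs, hsj⟩ := G.exists_root j
  have hr' : F₁.parent r = none := by rwa [parent_eq_none_iff, hn, ← parent_eq_none_iff]
  have hs' : F₁.parent s = none := by rwa [parent_eq_none_iff, hn, ← parent_eq_none_iff]
  obtain rfl : r = s := root_unique hr' hs'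
    ((root_le_iff hr' hij).1 (le_of_edge_le h hri)) (le_of_edge_le h hsj)
  exact G.part.trans (G.part.symm hri.part) hsj.part

/-- A subforest of `F` inherits its order from `F`, so only its partition can vary, and the
partition is forced to be that of `G`. -/
theorem Sub.eq_of_nodes_eq (h₁ : F₁.Sub F) (h₂ : F₂.Sub F)
    (hn₁ : F₁.nodes = G.nodes) (hn₂ : F₂.nodes = G.nodes)
    (hG₁ : ∀ i j, G.Edge i j → F₁.Le i j) (hG₂ : ∀ i j, G.Edge i j → F₂.Le i j) : F₁ = F₂ := by
  have hp := (part_eq_of_nodes_eq hn₁ hG₁).trans (part_eq_of_nodes_eq hn₂ hG₂).symm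
  refine ext_of_le fun i j => ⟨fun h => ?_, fun h => ?_⟩
  · exact (h₂.2 i j (hp ▸ h.part)).2 ((h₁.2 i j h.part).1 h)
  · exact (h₁.2 i j (hp ▸ h.part)).2 ((h₂.2 i j h.part).1 h)

/-- The subforest is the order of `F` restricted to the trees of `G`. -/
theorem exists_sub (h : ∀ i j, G.Edge i j → F.Le i j) :
    ∃ F₁ : RForest I, F₁.Sub F ∧ F₁.nodes = G.nodes ∧ ∀ i j, G.Edge i j → F₁.Le i j := by
  obtain ⟨H, hH⟩ := F.exists_le_iff G.part
  have hG : ∀ i j, G.Edge i j → H.Le i j := fun i j hij => (hH i j).2 ⟨h i j hij, hij.part⟩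
  refine ⟨H, ⟨part_le_of_edge fun i j hij => ((hH i j).1 hij.le).1.part, fun i j hij => ?_⟩,
    ?_, hG⟩
  · rw [hH, and_iff_left]
    exact part_le_of_edge (fun i j hij => ((hH i j).1 hij.le).2) hij
  · ext j
    constructor
    · intro hj
      -- A root of `G` is an ancestor of its whole tree for `G`, hence for `H`, and so has no proper
      -- ancestor in `H`.
      by_contra hj'
      rw [← parent_eq_none_iff] at hj'
      obtain ⟨i, hij⟩ := mem_nodes.1 hj
      have hji := (root_le_iff hj' ((hH i j).1 hij.le).2).2 (Le.refl G j)
      exact hij.ne (hij.le.antisymm (le_of_edge_le hG hji))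
    · intro hj
      obtain ⟨i, hij⟩ := mem_nodes.1 hj
      obtain ⟨k, hk, -⟩ := (hG i j hij).eq_or_edge.resolve_left hij.ne
      exact mem_nodes.2 ⟨k, hk⟩

end Subforests

end RForest

/-! ### Simple cycles -/

/-- A directed graph whose vertices have at most one predecessor, and which has a closed walk but
no loop, has a simple cycle of length at least two. -/
theorem exists_simple_cycle {I : Type*} {R : I → I → Prop} (hu : ∀ i k j, R i j → R k j → i = k)
    (hirr : ∀ i, ¬ R i i) {i : I} (hi : Relation.TransGen R i i) :
    ∃ (n : ℕ) (c : Fin (n + 1) → I), 1 ≤ n ∧ Function.Injective c ∧ ∀ k, R (c k) (c (k + 1)) := by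
  classical
  -- Predecessors are unique, so the closed walk read backwards is the orbit of `i` under `p`; the
  -- default value `j` is never used along it.
  let p : I → I := fun j => if h : ∃ i, R i j then h.choose else j
  have hp : ∀ {i j}, R i j → p j = i := by
    intro i j h
    have h' : ∃ i, R i j := ⟨i, h⟩
    simp only [p, dif_pos h']
    exact hu _ _ _ h'.choose_spec h
  have key : ∀ {a b}, Relation.TransGen R a b →
      ∃ m, p^[m + 1] b = a ∧ ∀ k ≤ m, R (p^[k + 1] b) (p^[k] b) := by
    intro a b hab
    induction hab with
    | @single b h => exact ⟨0, hp h, fun k hk => by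
        obtain rfl : k = 0 := by omega
        simpa [hp h] using h⟩
    | @tail b c _ h ih =>
      obtain ⟨m, hm, hR⟩ := ih
      refine ⟨m + 1, by rwa [Function.iterate_succ_apply, hp h], fun k hk => ?_⟩
      cases k with
      | zero => simpa [hp h] using h
      | succ k =>
        rw [Function.iterate_succ_apply p (k + 1) c, Function.iterate_succ_apply p k c, hp h]
        exact hR k (by omega)
  obtain ⟨m, hm, hR⟩ := key hi
  -- Cutting the walk at the minimal period makes its vertices pairwise different.
  have hper : Function.IsPeriodicPt p (m + 1) i := hm
  have hpos := hper.minimalPeriod_pos (Nat.succ_pos m)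
  have hle := hper.minimalPeriod_le (Nat.succ_pos m)
  have hmin := Function.iterate_minimalPeriod (f := p) (x := i)
  have hinj := Function.iterate_injOn_Iio_minimalPeriod (f := p) (x := i)
  generalize Function.minimalPeriod p i = N at *
  obtain ⟨n, rfl⟩ : ∃ n, N = n + 1 := ⟨N - 1, by omega⟩
  -- The orbit runs against the arrows, hence the reversed index. Period one would be a loop, and
  -- the step from the last vertex to vertex `0` closes up because `p^[n + 1] i = i`.
  refine ⟨n, fun k => p^[n - k] i, ?_, ?_, ?_⟩
  · rcases Nat.eq_zero_or_pos n with rfl | h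
    · exact absurd (by simpa [show p i = i from hmin] using hR 0 (Nat.zero_le _)) (hirr i)
    · exact h
  · intro a b hab
    have := hinj (Set.mem_Iio.2 (by omega)) (Set.mem_Iio.2 (by omega)) hab
    ext
    omega
  · intro k
    rcases eq_or_ne k (Fin.last n) with rfl | hk
    · have := hR n (by omega)
      rw [hmin] at this
      simpa using this
    · have hk' : (k : ℕ) < n := by
        have := Fin.val_lt_last hk
        simpa using this
      have h1 : ((k + 1 : Fin (n + 1)) : ℕ) = k + 1 := Fin.val_add_one_of_lt (by
        rwa [Fin.lt_def])
      simp only [h1]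
      have := hR (n - (k + 1)) (by omega)
      rwa [show n - (k + 1 : ℕ) + 1 = n - k by omega] at this

/-! ### Words in which the auxiliary element comes last -/

section Words

variable {I : Type*}

/-- The word `v` followed by the auxiliary element. -/
def orWord (v : List I) : List (Option I) := v.map some ++ [none]

theorem none_mem_orWord (v : List I) : none ∈ orWord v := by simp [orWord]

theorem some_mem_orWord {v : List I} {j : I} : some j ∈ orWord v ↔ j ∈ v := by simp [orWord]

theorem nodup_orWord {v : List I} (hv : v.Nodup) : (orWord v).Nodup := by
  refine List.Nodup.append (hv.map (Option.some_injective I)) (List.nodup_singleton _) ?_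
  simp [List.Disjoint]

variable [DecidableEq I]

theorem restrictWord_orWord [Fintype I] (v : List I) (N : Finset I) :
    restrictWord (orWord v) N = orWord (v.filter (· ∈ N)) := by
  simp [restrictWord, orWord, List.filter_map, Function.comp_def]

theorem relSign_orWord_swap {i j : I} (h : i ≠ j) :
    relSign (orWord [i, j]) (orWord [j, i]) = -1 := by
  have e : ∀ a b : I, orWord [a, b] = ([some a] ++ [some b]) ++ [none] := fun _ _ => rfl
  rw [e, e, relSign_append (by simp [or_comm]) (fun _ => Iff.rfl) (by simp [List.Disjoint]),
    relSign_append_comm (by simpa using h), relSign_self (List.nodup_singleton _)]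
  simp

/-- Exchanging the blocks `b` and `a` costs the sign; `b` then moves past the two letters `R₁` and
`r` at no cost. This is exactly the Koszul sign, which is why forms are normalized on the targets in
reverse order. -/
theorem splitSign_orWord {a b : List I} (h : (b ++ a).Nodup) :
    splitSign (orWord (b ++ a)) (orWord a) (orWord b) = (-1) ^ (a.length * b.length) := by
  have hinj : Function.Injective (Sum.inl : I → I ⊕ Fin 3) := Sum.inl_injective
  have hs : substWord (orWord (b ++ a)) =
      (b.map Sum.inl ++ a.map Sum.inl) ++ [Sum.inr 0, Sum.inr 1, Sum.inr 2] := by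
    simp [substWord, orWord, List.flatMap_append, List.flatMap_map, ← List.map_eq_flatMap]
  have hj : joinWord (orWord a) (orWord b) =
      a.map Sum.inl ++ (([Sum.inr 0, Sum.inr 1] ++ b.map Sum.inl) ++ [Sum.inr 2]) := by
    simp [joinWord, orWord, Function.comp_def]
  have hm : (a.map Sum.inl ++ b.map Sum.inl) ++ [Sum.inr 0, Sum.inr 1, Sum.inr 2] =
      a.map Sum.inl ++ ((b.map Sum.inl ++ [Sum.inr 0, Sum.inr 1]) ++
        [(Sum.inr 2 : I ⊕ Fin 3)]) := by simp
  have hb : (b.map (Sum.inl : I → I ⊕ Fin 3)).Nodup := h.of_append_left.map hinj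
  have ha : (a.map (Sum.inl : I → I ⊕ Fin 3)).Nodup := h.of_append_right.map hinj
  have hd := List.disjoint_of_nodup_append h
  have hba : (b.map (Sum.inl : I → I ⊕ Fin 3) ++ a.map Sum.inl).Nodup := by
    rw [← List.map_append]; exact h.map hinj
  have h1 : relSign ((b.map Sum.inl ++ a.map Sum.inl) ++ [Sum.inr 0, Sum.inr 1, Sum.inr 2])
      ((a.map Sum.inl ++ b.map Sum.inl) ++ [Sum.inr 0, Sum.inr 1, (Sum.inr 2 : I ⊕ Fin 3)]) =
      (-1) ^ (a.length * b.length) := by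
    rw [relSign_append (by simp [or_comm]) (fun _ => Iff.rfl) (by simp [List.Disjoint]),
      relSign_append_comm hba, relSign_self (by simp), mul_one, List.length_map, List.length_map,
      mul_comm]
  have h2 : relSign ((a.map Sum.inl ++ b.map Sum.inl) ++ [Sum.inr 0, Sum.inr 1, Sum.inr 2])
      (a.map Sum.inl ++ (([Sum.inr 0, Sum.inr 1] ++ b.map Sum.inl) ++
        [(Sum.inr 2 : I ⊕ Fin 3)])) = 1 := by
    rw [hm, relSign_append (fun _ => Iff.rfl) (by simp), relSign_self ha,
      relSign_append (by simp) (fun _ => Iff.rfl) (by simp [List.Disjoint]),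
      relSign_append_comm, relSign_self (List.nodup_singleton _)]
    · simp
    · exact List.Nodup.append hb (by simp) (by simp [List.Disjoint])
    · intro x hx hx'
      simp only [List.mem_map] at hx
      obtain ⟨y, hy, rfl⟩ := hx
      simp at hx'
      exact hd hx' hy
  have n1 : ((b.map Sum.inl ++ a.map Sum.inl) ++
      [Sum.inr 0, Sum.inr 1, (Sum.inr 2 : I ⊕ Fin 3)]).Nodup :=
    List.Nodup.append hba (by simp) (by simp [List.Disjoint])
  have n2 : ((a.map Sum.inl ++ b.map Sum.inl) ++
      [Sum.inr 0, Sum.inr 1, (Sum.inr 2 : I ⊕ Fin 3)]).Nodup :=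
    List.Nodup.append (List.nodup_append_comm.1 hba) (by simp) (by simp [List.Disjoint])
  have n3 : (a.map Sum.inl ++ (([Sum.inr 0, Sum.inr 1] ++ b.map Sum.inl) ++
      [(Sum.inr 2 : I ⊕ Fin 3)])).Nodup := by
    refine (List.Perm.nodup_iff ?_).1 n2
    rw [hm]
    exact (List.perm_append_comm.append_right _).append_left _
  rw [splitSign, hs, hj, relSign_trans n1 n2 n3 (by simp; tauto) (by simp), h1, h2, mul_one]

end Words

/-! ### Oriented forests and linear forms -/

section Forms

variable {I : Type*} [Fintype I] [DecidableEq I]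

/-- A forest, oriented by a list of its nodes followed by the auxiliary element. -/
def RForest.orient (F : RForest I) (v : List I) (hv : v.Nodup) (h : ∀ j, j ∈ v ↔ j ∈ F.nodes) :
    OrForest I where
  forest := F
  word := orWord v
  nodup := nodup_orWord hv
  none_mem := none_mem_orWord v
  some_mem j := by rw [some_mem_orWord, h]

/-- An arbitrary orientation of a forest. -/
noncomputable def RForest.orientation (F : RForest I) : OrForest I :=
  F.orient F.nodes.toList F.nodes.nodup_toList fun _ => Finset.mem_toList

/-! ### Evaluation of linear forms and of their products on oriented forests. -/

namespace ForDual

theorem add_apply (f g : ForDual I) (x : ForMod I) : (f + g) x = f x + g x := rfl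

theorem zero_apply (x : ForMod I) : (0 : ForDual I) x = 0 := rfl

theorem zsmul_apply (n : ℤ) (f : ForDual I) (x : ForMod I) : (n • f) x = n * f x :=
  LinearMap.smul_apply n (show ForMod I →ₗ[ℤ] ℤ from f) x

theorem sum_apply {ι : Type*} (s : Finset ι) (f : ι → ForDual I) (x : ForMod I) :
    (∑ i ∈ s, f i) x = ∑ i ∈ s, f i x :=
  LinearMap.sum_apply (M₂ := ℤ) s (fun i => show ForMod I →ₗ[ℤ] ℤ from f i) x

theorem map_zsmul' (f : ForDual I) (n : ℤ) (x : ForMod I) : f (n • x) = n * f x :=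
  LinearMap.map_smul (show ForMod I →ₗ[ℤ] ℤ from f) n x

theorem apply_of_eq (f : ForDual I) {a b : OrForest I} (h : a.forest = b.forest) :
    f (ForMod.of a) = relSign a.word b.word * f (ForMod.of b) := by
  rw [ForMod.of_eq h, map_zsmul']

/-- One orientation per forest suffices, since the others differ by a sign. Leaving it free allows
each application to take the orientation adapted to its arrows. -/
theorem ext_of {f g : ForDual I}
    (h : ∀ F : RForest I, ∃ a : OrForest I, a.forest = F ∧ f (ForMod.of a) = g (ForMod.of a)) :
    f = g := by
  have key : ∀ a, f (ForMod.of a) = g (ForMod.of a) := by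
    intro a
    obtain ⟨b, hb, hfg⟩ := h a.forest
    rw [apply_of_eq f hb.symm, apply_of_eq g hb.symm, hfg]
  have : (show ForMod I →ₗ[ℤ] ℤ from f) = g := by
    refine Submodule.linearMap_qext _ (Finsupp.lhom_ext' fun a => LinearMap.ext_ring ?_)
    exact key a
  exact this

theorem map_proj_of (f : ForMod I →ₗ[ℤ] ℤ) (n : ℕ) (a : OrForest I) :
    f (ForMod.proj I n (ForMod.of a)) =
      if a.forest.nodes.card = n then f (ForMod.of a) else 0 := by
  rw [ForMod.proj, ForMod.lift_of, apply_ite f, map_zero]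

theorem sum_range_pairing_tmul (f g : ForMod I →ₗ[ℤ] ℤ) (b c : OrForest I) :
    (∑ p ∈ Finset.range (Fintype.card I + 1), ∑ q ∈ Finset.range (Fintype.card I + 1),
      (-1 : ℤ) ^ (p * q) • (LinearMap.mul' ℤ ℤ ∘ₗ TensorProduct.map
        (f.comp (ForMod.proj I p)) (g.comp (ForMod.proj I q))))
          (ForMod.of b ⊗ₜ[ℤ] ForMod.of c) =
      (-1) ^ (b.forest.nodes.card * c.forest.nodes.card) *
        (f (ForMod.of b) * g (ForMod.of c)) := by
  have hr : ∀ a : OrForest I, a.forest.nodes.card ∈ Finset.range (Fintype.card I + 1) :=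
    fun a => Finset.mem_range.2 (Nat.lt_succ_of_le (Finset.card_le_univ _))
  simp only [LinearMap.sum_apply, LinearMap.smul_apply, LinearMap.comp_apply,
    TensorProduct.map_tmul, LinearMap.mul'_apply, map_proj_of, smul_eq_mul]
  rw [Finset.sum_eq_single_of_mem _ (hr b), Finset.sum_eq_single_of_mem _ (hr c)]
  · simp
  · intro q _ hq
    simp [hq.symm]
  · intro p _ hp
    simp [hp.symm]

theorem koszulPairing_tmul (f g : ForDual I) (b c : OrForest I) :
    koszulPairing f g (ForMod.of b ⊗ₜ[ℤ] ForMod.of c) =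
      (-1) ^ (b.forest.nodes.card * c.forest.nodes.card) *
        (f (ForMod.of b) * g (ForMod.of c)) :=
  sum_range_pairing_tmul f g b c

theorem mul_apply_of (f g : ForDual I) (a : OrForest I) :
    (f * g) (ForMod.of a) =
      ∑ N : {N // N ∈ a.forest.nodes.powerset},
        ∑ F₁ : {F₁ // F₁ ∈ a.forest.gam N.1},
          ∑ F₂ : {F₂ // F₂ ∈ a.forest.gam (a.forest.nodes \ N.1)},
            splitSign a.word (restrictWord a.word F₁.1.nodes) (restrictWord a.word F₂.1.nodes) *
              ((-1) ^ (F₁.1.nodes.card * F₂.1.nodes.card) *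
                (f (ForMod.of (a.restrict F₁.1 (by
                  rw [RForest.nodes_of_mem_gam F₁.2]; exact Finset.mem_powerset.1 N.2))) *
                g (ForMod.of (a.restrict F₂.1 (by
                  rw [RForest.nodes_of_mem_gam F₂.2]; exact Finset.sdiff_subset))))) := by
  have h1 : (f * g) (ForMod.of a) = koszulPairing f g (ForMod.comul I (ForMod.of a)) := rfl
  rw [h1, ForMod.comul, ForMod.lift_of, comulAux]
  simp only [map_sum, map_smul, koszulPairing_tmul, smul_eq_mul]
  rfl

theorem add_mul' (f g h : ForDual I) : (f + g) * h = f * h + g * h := by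
  refine ext_of fun F => ⟨F.orientation, rfl, ?_⟩
  simp only [add_apply, mul_apply_of, ← Finset.sum_add_distrib]
  refine Finset.sum_congr rfl fun _ _ => Finset.sum_congr rfl fun _ _ =>
    Finset.sum_congr rfl fun _ _ => by ring

theorem mul_add' (f g h : ForDual I) : f * (g + h) = f * g + f * h := by
  refine ext_of fun F => ⟨F.orientation, rfl, ?_⟩
  simp only [add_apply, mul_apply_of, ← Finset.sum_add_distrib]
  refine Finset.sum_congr rfl fun _ _ => Finset.sum_congr rfl fun _ _ =>
    Finset.sum_congr rfl fun _ _ => by ring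

end ForDual

end Forms

/-! ### The linear forms of lists of arrows -/

/-- The pairs `(i, j)` with `i ≠ j`, seen as arrows `i ← j`. -/
abbrev Arrow (I : Type*) : Type _ := {p : I × I // p.1 ≠ p.2}

theorem RForest.mem_gam {I : Type*} [Fintype I] [DecidableEq I] {F F' : RForest I}
    {N : Finset I} : F' ∈ F.gam N ↔ F'.Sub F ∧ F'.nodes = N := by
  simp [RForest.gam]

namespace Arrow

variable {I : Type*}

/-- The vertices `j` of the arrows `i ← j` of a list. -/
def targets (s : List (Arrow I)) : List I := s.map fun e => e.1.2

theorem targets_append (s t : List (Arrow I)) : targets (s ++ t) = targets s ++ targets t :=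
  List.map_append

theorem mem_targets {s : List (Arrow I)} {j : I} : j ∈ targets s ↔ ∃ e ∈ s, e.1.2 = j :=
  List.mem_map

theorem eq_of_mem {s : List (Arrow I)} (hs : (targets s).Nodup) {e e' : Arrow I} (he : e ∈ s)
    (he' : e' ∈ s) (h : e.1.2 = e'.1.2) : e = e' :=
  List.inj_on_of_nodup_map hs he he' h

/-- The graph of the arrows of a list. -/
def Rel (s : List (Arrow I)) (i j : I) : Prop := ∃ e ∈ s, e.1 = (i, j)

theorem Rel.unique {s : List (Arrow I)} (hs : (targets s).Nodup) (i k j : I) (h : Rel s i j)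
    (h' : Rel s k j) : i = k := by
  obtain ⟨e, he, h1⟩ := h
  obtain ⟨e', he', h1'⟩ := h'
  have := eq_of_mem hs he he' (by rw [h1, h1'])
  rw [← this, h1] at h1'
  exact (Prod.mk.inj h1').1

/-- The two ends of an arrow differ, so each arrow is a strict ascent of `F`, and strict ascents
cannot close up. -/
theorem not_transGen_of_le {s : List (Arrow I)} {F : RForest I}
    (h : ∀ e ∈ s, F.Le e.1.1 e.1.2) (i : I) : ¬ Relation.TransGen (Rel s) i i := by
  have key : ∀ {a b}, Relation.TransGen (Rel s) a b → Relation.TransGen F.Edge a b := by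
    have h1 : ∀ {a b}, Rel s a b → Relation.TransGen F.Edge a b := by
      rintro a b ⟨e, he, hab⟩
      have := RForest.transGen_of_le_of_ne (h e he) e.2
      rwa [hab] at this
    intro a b hab
    induction hab with
    | single h => exact h1 h
    | tail _ h ih => exact ih.trans (h1 h)
  exact fun hi => F.acyclic i (key hi)

/-! ### Forests compatible with a list of arrows. -/

variable [Fintype I]

/-- The nodes of `F` are the targets of the arrows of `s`, without repetition, and `F` is
compatible with these arrows. -/
structure Compatible (s : List (Arrow I)) (F : RForest I) : Prop where
  nodup : (targets s).Nodup
  mem_iff : ∀ j, j ∈ targets s ↔ j ∈ F.nodes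
  le : ∀ e ∈ s, F.Le e.1.1 e.1.2

/-- The forest with given arrows. -/
theorem exists_forest {s : List (Arrow I)} (hs : (targets s).Nodup)
    (ha : ∀ i, ¬ Relation.TransGen (Rel s) i i) :
    ∃ G : RForest I, (∀ i j, G.Edge i j ↔ Rel s i j) ∧ ∀ j, j ∈ targets s ↔ j ∈ G.nodes := by
  obtain ⟨G, hG⟩ := RForest.exists_edge_iff (Rel s) (Rel.unique hs) ha
  refine ⟨G, hG, fun j => ?_⟩
  simp only [RForest.mem_nodes, hG, mem_targets, Rel]
  constructor
  · rintro ⟨e, he, rfl⟩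
    exact ⟨e.1.1, e, he, rfl⟩
  · rintro ⟨i, e, he, h⟩
    exact ⟨e, he, by rw [h]⟩

/-- If `F` is compatible with arrows with pairwise different targets, then there is a unique
subforest of `F` which is compatible with these arrows and has no other nodes. -/
theorem existsUnique_sub {s : List (Arrow I)} {F : RForest I} (hs : (targets s).Nodup)
    (h : ∀ e ∈ s, F.Le e.1.1 e.1.2) :
    ∃! F₁ : RForest I, F₁.Sub F ∧ Compatible s F₁ := by
  -- The list is replaced by the forest `G` whose edges are its arrows: compatibility now means
  -- having the nodes of `G` and making its edges ascents.
  obtain ⟨G, hG, hGn⟩ := exists_forest hs (not_transGen_of_le h)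
  have iff_edge : ∀ F' : RForest I, (∀ e ∈ s, F'.Le e.1.1 e.1.2) ↔
      ∀ i j, G.Edge i j → F'.Le i j := by
    intro F'
    constructor
    · intro h i j hij
      obtain ⟨e, he, hij⟩ := (hG i j).1 hij
      have := h e he
      rwa [hij] at this
    · exact fun h e he => h _ _ ((hG _ _).2 ⟨e, he, rfl⟩)
  have nodes_eq : ∀ F' : RForest I, Compatible s F' → F'.nodes = G.nodes := by
    intro F' h
    ext j
    rw [← h.mem_iff, hGn]
  obtain ⟨F₁, h1, h2, h3⟩ := RForest.exists_sub ((iff_edge F).1 h)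
  refine ⟨F₁, ⟨h1, hs, fun j => by rw [hGn, h2], (iff_edge F₁).2 h3⟩, ?_⟩
  rintro F₂ ⟨h4, h5⟩
  exact h4.eq_of_nodes_eq h1 (nodes_eq _ h5) h2 ((iff_edge F₂).1 h5.le) h3

theorem Compatible.le_of_sub {s : List (Arrow I)} {F F₁ : RForest I} (h : Compatible s F₁)
    (h' : F₁.Sub F) {e : Arrow I} (he : e ∈ s) : F.Le e.1.1 e.1.2 :=
  (h'.2 _ _ (h.le e he).part).1 (h.le e he)

/-! ### The forms of lists of arrows and their products. -/

variable [DecidableEq I]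

theorem Compatible.card_nodes {s : List (Arrow I)} {F : RForest I} (h : Compatible s F) :
    F.nodes.card = (targets s).length := by
  rw [← List.toFinset_card_of_nodup h.nodup]
  congr 1
  ext j
  rw [List.mem_toFinset, h.mem_iff]

theorem Compatible.relSign_eq {s : List (Arrow I)} {a b : OrForest I} (h : Compatible s b.forest)
    (hab : a.forest = b.forest) : relSign a.word (orWord (targets s).reverse) =
      relSign a.word b.word * relSign b.word (orWord (targets s).reverse) := by
  refine relSign_trans a.nodup b.nodup (nodup_orWord (List.nodup_reverse.2 h.nodup))
    (OrForest.mem_iff hab) ?_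
  rintro (_ | j)
  · exact iff_of_true b.none_mem (none_mem_orWord _)
  · rw [b.some_mem, some_mem_orWord, List.mem_reverse, h.mem_iff]

open Classical in
/-- The linear form on oriented forests which takes the value one on the forests compatible with
the arrows of `s`, oriented by the targets of these arrows in the reverse order. -/
noncomputable def dual (s : List (Arrow I)) : ForDual I :=
  (ForMod.lift (fun a => if Compatible s a.forest then
      relSign a.word (orWord (targets s).reverse) else 0) (by
    intro a b hab
    simp only [hab]
    split_ifs with h
    · exact h.relSign_eq hab
    · simp) : ForMod I →ₗ[ℤ] ℤ)

open Classical in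
theorem dual_of (s : List (Arrow I)) (a : OrForest I) : dual s (ForMod.of a) =
    if Compatible s a.forest then relSign a.word (orWord (targets s).reverse) else 0 :=
  ForMod.lift_of (fun a => if Compatible s a.forest then
    relSign a.word (orWord (targets s).reverse) else 0) _ a

theorem dual_apply_of_not {s : List (Arrow I)} {a : OrForest I} (h : ¬ Compatible s a.forest) :
    dual s (ForMod.of a) = 0 := by
  rw [dual_of, if_neg h]

theorem dual_apply {s : List (Arrow I)} {a : OrForest I} (h : Compatible s a.forest) :
    dual s (ForMod.of a) = relSign a.word (orWord (targets s).reverse) := by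
  rw [dual_of, if_pos h]

theorem dual_apply_eq_one {s : List (Arrow I)} {a : OrForest I} (h : Compatible s a.forest)
    (hw : a.word = orWord (targets s).reverse) : dual s (ForMod.of a) = 1 := by
  rw [dual_apply h, hw, relSign_self (nodup_orWord (List.nodup_reverse.2 h.nodup))]

theorem dual_eq_zero {s : List (Arrow I)} (h : ∀ F : RForest I, ¬ Compatible s F) :
    dual s = 0 :=
  ForDual.ext_of fun F => ⟨F.orientation, rfl, dual_apply_of_not (h _)⟩

/-- The orientation of a compatible forest given by the arrows. -/
def Compatible.orient {s : List (Arrow I)} {F : RForest I} (h : Compatible s F) : OrForest I :=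
  F.orient (targets s).reverse (List.nodup_reverse.2 h.nodup)
    fun j => by rw [List.mem_reverse, h.mem_iff]

theorem dual_nil : dual ([] : List (Arrow I)) = 1 := by
  refine ForDual.ext_of fun F => ?_
  have h1 : ∀ a : OrForest I, (1 : ForDual I) (ForMod.of a) =
      if a.forest.nodes = ∅ then 1 else 0 := fun a =>
    show ForMod.counit I (ForMod.of a) = _ by rw [ForMod.counit, ForMod.lift_of]
  by_cases h : Compatible [] F
  · refine ⟨h.orient, rfl, ?_⟩
    rw [h1, dual_apply_eq_one h rfl, if_pos]
    exact Finset.eq_empty_of_forall_notMem fun j hj => by simpa [targets] using (h.mem_iff j).2 hj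
  · refine ⟨F.orientation, rfl, ?_⟩
    rw [h1, dual_apply_of_not h, if_neg]
    intro (h' : F.nodes = ∅)
    exact h ⟨by simp [targets], fun j => by simp [targets, h'], by simp⟩

/-- If `F` is compatible with `s ++ t`, uniqueness of compatible subforests leaves one term of the
coproduct. Conversely, ascents of subforests are ascents of `F`, so any nonzero term makes `F`
compatible. -/
theorem dual_append (s t : List (Arrow I)) : dual s * dual t = dual (s ++ t) := by
  refine ForDual.ext_of fun F => ?_
  by_cases h : Compatible (s ++ t) F
  · refine ⟨h.orient, rfl, ?_⟩
    rw [dual_apply_eq_one h rfl, ForDual.mul_apply_of]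
    have hnd := h.nodup
    rw [targets_append] at hnd
    have hd := List.disjoint_of_nodup_append hnd
    have hmem := h.mem_iff
    simp only [targets_append, List.mem_append] at hmem
    obtain ⟨F₁, ⟨s1, c1⟩, u1⟩ := existsUnique_sub hnd.of_append_left
      fun e he => h.le e (List.mem_append_left t he)
    obtain ⟨F₂, ⟨s2, c2⟩, u2⟩ := existsUnique_sub hnd.of_append_right
      fun e he => h.le e (List.mem_append_right s he)
    have hsub : F₁.nodes ⊆ F.nodes := fun j hj => (hmem j).1 (Or.inl ((c1.mem_iff j).2 hj))
    have hn2 : F₂.nodes = F.nodes \ F₁.nodes := by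
      ext j
      rw [Finset.mem_sdiff, ← hmem, ← c1.mem_iff, ← c2.mem_iff]
      have := @hd j
      tauto
    have m1 : F₁ ∈ F.gam F₁.nodes := RForest.mem_gam.2 ⟨s1, rfl⟩
    have m2 : F₂ ∈ F.gam (F.nodes \ F₁.nodes) := RForest.mem_gam.2 ⟨s2, hn2⟩
    have f1 : (targets (s ++ t)).reverse.filter (· ∈ F₁.nodes) = (targets s).reverse := by
      rw [targets_append, List.reverse_append, List.filter_append, List.filter_eq_nil_iff.2,
        List.filter_eq_self.2, List.nil_append]
      · intro j hj
        simpa [← c1.mem_iff] using hj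
      · intro j hj
        simp only [← c1.mem_iff, decide_eq_true_eq]
        exact fun hj' => hd hj' (List.mem_reverse.1 hj)
    have f2 : (targets (s ++ t)).reverse.filter (· ∈ F₂.nodes) = (targets t).reverse := by
      rw [targets_append, List.reverse_append, List.filter_append, List.filter_eq_self.2,
        List.filter_eq_nil_iff.2, List.append_nil]
      · intro j hj
        simp only [← c2.mem_iff, decide_eq_true_eq]
        exact hd (List.mem_reverse.1 hj)
      · intro j hj
        simpa [← c2.mem_iff] using hj
    have w1 : restrictWord h.orient.word F₁.nodes = orWord (targets s).reverse :=
      (restrictWord_orWord _ _).trans (congrArg orWord f1)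
    have w2 : restrictWord h.orient.word F₂.nodes = orWord (targets t).reverse :=
      (restrictWord_orWord _ _).trans (congrArg orWord f2)
    have w : h.orient.word = orWord ((targets t).reverse ++ (targets s).reverse) := by
      rw [← List.reverse_append, ← targets_append]
      rfl
    -- The set `N` must consist of the targets of `s`, and both subforests are then unique.
    rw [Fintype.sum_eq_single ⟨F₁.nodes, Finset.mem_powerset.2 hsub⟩,
      Fintype.sum_eq_single ⟨F₁, m1⟩, Fintype.sum_eq_single ⟨F₂, m2⟩,
      dual_apply_eq_one (a := h.orient.restrict F₁ _) c1 w1,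
      dual_apply_eq_one (a := h.orient.restrict F₂ _) c2 w2]
    · simp only []
      -- The splitting sign and the Koszul sign are the same power of `-1`, and their product is
      -- `1`.
      rw [w1, w2, w, splitSign_orWord, c1.card_nodes, c2.card_nodes, List.length_reverse,
        List.length_reverse, mul_one, mul_one, ← mul_pow]
      · simp
      · rw [← List.reverse_append]
        exact List.nodup_reverse.2 hnd
    · rintro ⟨F', hF'⟩ hne
      rw [dual_apply_of_not (s := t), mul_zero, mul_zero, mul_zero]
      intro c
      exact hne (Subtype.ext (u2 F' ⟨(RForest.mem_gam.1 hF').1, c⟩))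
    · rintro ⟨F', hF'⟩ hne
      refine Finset.sum_eq_zero fun F'' _ => ?_
      rw [dual_apply_of_not (s := s), zero_mul, mul_zero, mul_zero]
      intro c
      exact hne (Subtype.ext (u1 F' ⟨(RForest.mem_gam.1 hF').1, c⟩))
    · rintro ⟨N, hN⟩ hne
      refine Finset.sum_eq_zero fun F' _ => Finset.sum_eq_zero fun F'' _ => ?_
      rw [dual_apply_of_not (s := s), zero_mul, mul_zero, mul_zero]
      intro c
      refine hne (Subtype.ext ?_)
      have h1 := RForest.nodes_of_mem_gam F'.2
      ext j
      rw [← c1.mem_iff, ← h1]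
      exact (c.mem_iff j).symm
  · refine ⟨F.orientation, rfl, ?_⟩
    rw [dual_apply_of_not h, ForDual.mul_apply_of]
    refine Finset.sum_eq_zero fun N _ => Finset.sum_eq_zero fun F₁ _ =>
      Finset.sum_eq_zero fun F₂ _ => ?_
    by_cases c1 : Compatible s F₁.1
    · by_cases c2 : Compatible t F₂.1
      · refine absurd ?_ h
        have n1 := RForest.nodes_of_mem_gam F₁.2
        have n2 := RForest.nodes_of_mem_gam F₂.2
        have hN : N.1 ⊆ F.nodes := Finset.mem_powerset.1 N.2
        change F₂.1.nodes = F.nodes \ N.1 at n2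
        refine ⟨?_, fun j => ?_, fun e he => ?_⟩
        · rw [targets_append]
          refine List.Nodup.append c1.nodup c2.nodup fun j hj hj' => ?_
          rw [c1.mem_iff, n1] at hj
          rw [c2.mem_iff, n2, Finset.mem_sdiff] at hj'
          exact hj'.2 hj
        · rw [targets_append, List.mem_append, c1.mem_iff, c2.mem_iff, n1, n2, Finset.mem_sdiff]
          have := @hN j
          tauto
        · rcases List.mem_append.1 he with he | he
          · exact c1.le_of_sub (RForest.mem_gam.1 F₁.2).1 he
          · exact c2.le_of_sub (RForest.mem_gam.1 F₂.2).1 he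
      · rw [dual_apply_of_not (s := t) c2, mul_zero, mul_zero, mul_zero]
    · rw [dual_apply_of_not (s := s) c1, zero_mul, mul_zero, mul_zero]

theorem dual_eq_zero_of_not_nodup {s : List (Arrow I)} (h : ¬ (targets s).Nodup) : dual s = 0 :=
  dual_eq_zero fun _ hF => h hF.nodup

/-- Both lists have the same compatible forests, and their orientations differ by one transposition.
-/
theorem dual_pair_add (e e' : Arrow I) : dual [e, e'] + dual [e', e] = 0 := by
  refine ForDual.ext_of fun F => ?_
  simp only [ForDual.zero_apply]
  have hperm : [e, e'].Perm [e', e] := List.Perm.swap _ _ _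
  have hc : ∀ {s t : List (Arrow I)}, s.Perm t → Compatible s F → Compatible t F :=
    fun hp c => ⟨((hp.map _).nodup_iff).1 c.nodup,
      fun j => by rw [← c.mem_iff]; exact (hp.map _).symm.mem_iff,
      fun x hx => c.le x (hp.mem_iff.2 hx)⟩
  by_cases h : Compatible [e, e'] F
  · refine ⟨h.orient, rfl, ?_⟩
    have hne : e'.1.2 ≠ e.1.2 := by
      have := h.nodup
      simp only [targets, List.map_cons, List.map_nil, List.nodup_cons, List.mem_singleton] at this
      exact fun h => this.1 h.symm
    rw [ForDual.add_apply, dual_apply_eq_one h rfl,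
      dual_apply (s := [e', e]) (a := h.orient) (hc hperm h)]
    have : relSign h.orient.word (orWord (targets [e', e]).reverse) = -1 :=
      relSign_orWord_swap hne
    rw [this]
    rfl
  · refine ⟨F.orientation, rfl, ?_⟩
    rw [ForDual.add_apply, dual_apply_of_not h,
      dual_apply_of_not fun c => h (hc hperm.symm c), add_zero]

end Arrow

/-! ### Unitriangular families -/

section Triangular

variable {ι A : Type*} [Fintype ι] [AddCommGroup A] {ψ : ι → A} {ev : ι → A →+ ℤ} {h : ι → ℕ}

/-- Gaussian elimination by increasing height: subtracting the right multiples of the `ψ j` of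
height `m` kills the values at height `m` without disturbing those below. The diagonal entries are
`1`, so no division occurs. -/
theorem span_eq_top_of_unitriangular (hev : ∀ x, (∀ i, ev i x = 0) → x = 0)
    (h1 : ∀ i, ev i (ψ i) = 1) (h0 : ∀ i j, i ≠ j → h i ≤ h j → ev i (ψ j) = 0) :
    Submodule.span ℤ (Set.range ψ) = ⊤ := by
  classical
  have hle : ∀ i, h i ≤ Finset.univ.sup h := fun i => Finset.le_sup (Finset.mem_univ i)
  -- Here `m` is the height below which `x` already vanishes, and `d` counts the heights which
  -- remain.
  have key : ∀ d m : ℕ, m + d = Finset.univ.sup h + 1 → ∀ x, (∀ i, h i < m → ev i x = 0) →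
      x ∈ Submodule.span ℤ (Set.range ψ) := by
    intro d
    induction d with
    | zero =>
      intro m hm x hx
      rw [hev x fun i => hx i (by have := hle i; omega)]
      exact zero_mem _
    | succ d ih =>
      intro m hm x hx
      rw [← sub_add_cancel x (∑ j with h j = m, ev j x • ψ j)]
      refine add_mem (ih (m + 1) (by omega) _ fun i hi => ?_)
        (sum_mem fun j _ => Submodule.smul_mem _ _ (Submodule.subset_span ⟨j, rfl⟩))
      rw [map_sub, map_sum]
      simp only [map_zsmul, smul_eq_mul]
      rcases Nat.lt_or_ge (h i) m with him | him
      · rw [hx i him, Finset.sum_eq_zero, sub_zero]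
        intro j hj
        have hj' : h j = m := (Finset.mem_filter.1 hj).2
        rw [h0 i j (by rintro rfl; omega) (by omega), mul_zero]
      · rw [Finset.sum_eq_single i, h1, mul_one, sub_self]
        · intro j hj hji
          have hj' : h j = m := (Finset.mem_filter.1 hj).2
          rw [h0 i j (Ne.symm hji) (by omega), mul_zero]
        · exact fun hi' => absurd (Finset.mem_filter.2 ⟨Finset.mem_univ i, by omega⟩) hi'
  exact Submodule.eq_top_iff'.2 fun x => key _ 0 (Nat.zero_add _) x fun i hi => absurd hi (by simp)

/-- Evaluate a relation at `i`: terms of smaller height have zero coefficient by induction, and the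
others vanish at `i`, except the one of `i`. -/
theorem linearIndependent_of_unitriangular (h1 : ∀ i, ev i (ψ i) = 1)
    (h0 : ∀ i j, i ≠ j → h i ≤ h j → ev i (ψ j) = 0) : LinearIndependent ℤ ψ := by
  rw [Fintype.linearIndependent_iff]
  intro g hg
  have key : ∀ n i, h i = n → g i = 0 := by
    intro n
    induction n using Nat.strong_induction_on with
    | _ n ih =>
      rintro i rfl
      have := congrArg (ev i) hg
      rw [map_sum, map_zero, Finset.sum_eq_single i] at this
      · simpa [h1] using this
      · intro j _ hji
        rcases Nat.lt_or_ge (h j) (h i) with hj | hj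
        · rw [ih _ hj j rfl, zero_smul, map_zero]
        · rw [map_zsmul, h0 i j (Ne.symm hji) hj, smul_zero]
      · exact fun hi => absurd (Finset.mem_univ i) hi
  exact fun i => key _ i rfl

end Triangular

/-! ### The basis of the dual given by the arrows of forests -/

namespace RForest

variable {I : Type*} [Fintype I]

/-- The list of the arrows of a forest which end at the nodes of a list. -/
def arrows (F : RForest I) (l : List F.nodes) : List (Arrow I) :=
  l.map fun j => ⟨(F.par j, j), F.par_ne j⟩

theorem targets_arrows (F : RForest I) (l : List F.nodes) :
    Arrow.targets (F.arrows l) = l.map Subtype.val := by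
  simp [Arrow.targets, arrows]

theorem mem_targets_arrows {F : RForest I} {l : List F.nodes} (hl : ∀ j, j ∈ l) (j : I) :
    j ∈ Arrow.targets (F.arrows l) ↔ j ∈ F.nodes := by
  rw [targets_arrows, List.mem_map]
  exact ⟨by rintro ⟨j, -, rfl⟩; exact j.2, fun h => ⟨⟨j, h⟩, hl _, rfl⟩⟩

theorem nodup_targets_arrows {F : RForest I} {l : List F.nodes} (hl : l.Nodup) :
    (Arrow.targets (F.arrows l)).Nodup := by
  rw [targets_arrows]
  exact hl.map Subtype.val_injective

theorem mem_arrows {F : RForest I} {l : List F.nodes} (hl : ∀ j, j ∈ l) {e : Arrow I} :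
    e ∈ F.arrows l ↔ F.Edge e.1.1 e.1.2 := by
  rw [arrows, List.mem_map]
  constructor
  · rintro ⟨j, -, rfl⟩
    exact F.edge_par j
  · intro h
    refine ⟨⟨e.1.2, mem_nodes.2 ⟨_, h⟩⟩, hl _, Subtype.ext (Prod.ext ?_ rfl)⟩
    exact (F.edge_par _).unique h

theorem compatible_arrows_iff {F G : RForest I} {l : List F.nodes} (hl : l.Nodup)
    (hl' : ∀ j, j ∈ l) : Arrow.Compatible (F.arrows l) G ↔
      F.nodes = G.nodes ∧ ∀ i j, F.Edge i j → G.Le i j := by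
  constructor
  · intro h
    refine ⟨?_, fun i j hij => h.le ⟨(i, j), hij.ne⟩ ((mem_arrows hl').2 hij)⟩
    ext j
    rw [← h.mem_iff, mem_targets_arrows hl']
  · rintro ⟨h, h'⟩
    exact ⟨nodup_targets_arrows hl, fun j => by rw [mem_targets_arrows hl', h],
      fun e he => h' _ _ ((mem_arrows hl').1 he)⟩

open Classical in
/-- The number of pairs in the ascendance relation. -/
noncomputable def height (F : RForest I) : ℕ :=
  (Finset.univ.filter fun p : I × I => F.Le p.1 p.2).card

/-- The order of `G` contains that of `F`, so it cannot be a proper extension without having more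
pairs. -/
theorem eq_of_height_le {F G : RForest I} (h : ∀ i j, F.Edge i j → G.Le i j)
    (hh : G.height ≤ F.height) : F = G := by
  classical
  refine ext_of_le fun i j => ⟨le_of_edge_le h, fun hij => ?_⟩
  have := Finset.eq_of_subset_of_card_le (s := Finset.univ.filter fun p : I × I => F.Le p.1 p.2)
    (t := Finset.univ.filter fun p : I × I => G.Le p.1 p.2)
    (fun p hp => by
      simp only [Finset.mem_filter, Finset.mem_univ, true_and] at hp ⊢
      exact le_of_edge_le h hp)
    (by simpa only [height] using hh)
  have hm : (i, j) ∈ Finset.univ.filter fun p : I × I => G.Le p.1 p.2 := by simpa using hij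
  rw [← this] at hm
  simpa using hm

end RForest

namespace ForDual

variable {I : Type*} [Fintype I] [DecidableEq I]

/-- Evaluation at an oriented forest. -/
noncomputable def eval (a : OrForest I) : ForDual I →+ ℤ where
  toFun f := f (ForMod.of a)
  map_zero' := rfl
  map_add' _ _ := rfl

section Arrows

variable {w : (F : RForest I) → List F.nodes} (hw : ∀ F, (w F).Nodup ∧ ∀ j, j ∈ w F)
include hw

/-- If the form of `G` is nonzero at `F`, then `≤_F` extends `≤_G`, so `F` has strictly greater
height unless `F = G`. -/
theorem eval_unitriangular : ∃ o : RForest I → OrForest I, (∀ F, (o F).forest = F) ∧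
    (∀ F, eval (o F) (Arrow.dual (F.arrows (w F))) = 1) ∧
    ∀ F G, F ≠ G → F.height ≤ G.height → eval (o F) (Arrow.dual (G.arrows (w G))) = 0 := by
  have hc : ∀ F, Arrow.Compatible (F.arrows (w F)) F := fun F =>
    (RForest.compatible_arrows_iff (hw F).1 (hw F).2).2 ⟨rfl, fun i j h => h.le⟩
  refine ⟨fun F => (hc F).orient, fun F => rfl, fun F => Arrow.dual_apply_eq_one (hc F) rfl,
    fun F G hFG hh => Arrow.dual_apply_of_not fun h => hFG ?_⟩
  exact (RForest.eq_of_height_le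
    ((RForest.compatible_arrows_iff (hw G).1 (hw G).2).1 h).2 hh).symm

theorem span_dual_arrows :
    Submodule.span ℤ (Set.range fun F : RForest I => Arrow.dual (F.arrows (w F))) = ⊤ := by
  obtain ⟨o, ho, h1, h0⟩ := eval_unitriangular hw
  exact span_eq_top_of_unitriangular (ev := fun F => eval (o F))
    (fun f hf => ext_of fun F => ⟨o F, ho F, hf F⟩) h1 h0

theorem linearIndependent_dual_arrows :
    LinearIndependent ℤ fun F : RForest I => Arrow.dual (F.arrows (w F)) := by
  obtain ⟨o, -, h1, h0⟩ := eval_unitriangular hw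
  exact linearIndependent_of_unitriangular (ev := fun F => eval (o F)) h1 h0

end Arrows

/-- Additive identities in the dual need only be checked on the forms of lists, where multiplication
is concatenation. -/
theorem induction_dual {p : ForDual I → Prop} (f : ForDual I) (dual : ∀ s, p (Arrow.dual s))
    (add : ∀ f g, p f → p g → p (f + g)) (neg : ∀ f, p f → p (-f)) (zero : p 0) : p f := by
  have hf : f ∈ Submodule.span ℤ (Set.range fun F : RForest I =>
      Arrow.dual (F.arrows Finset.univ.toList)) := by
    rw [span_dual_arrows (w := fun F => Finset.univ.toList)
      fun F => ⟨Finset.nodup_toList _, fun j => by simp⟩]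
    trivial
  rw [← Submodule.mem_toAddSubgroup, Submodule.span_int_eq_addSubgroupClosure] at hf
  induction hf using AddSubgroup.closure_induction with
  | mem x hx => obtain ⟨F, rfl⟩ := hx; exact dual _
  | zero => exact zero
  | add x y _ _ hx hy => exact add x y hx hy
  | neg x _ hx => exact neg x hx

/-- The product of `F*(I)` is biadditive. -/
noncomputable abbrev nonUnitalNonAssocRing (I : Type*) [Fintype I] [DecidableEq I] :
    NonUnitalNonAssocRing (ForDual I) :=
  { (inferInstance : AddCommGroup (ForDual I)) with
    mul := (· * ·)
    left_distrib := mul_add'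
    right_distrib := add_mul'
    zero_mul := fun f => by
      have := add_mul' 0 0 f
      rwa [add_zero, left_eq_add] at this
    mul_zero := fun f => by
      have := mul_add' f 0 0
      rwa [add_zero, left_eq_add] at this }

-- Associativity and unit of the dual product.

attribute [local instance] nonUnitalNonAssocRing

theorem mul_assoc' (f g h : ForDual I) : f * g * h = f * (g * h) := by
  induction f using induction_dual with
  | dual s =>
    induction g using induction_dual with
    | dual t =>
      induction h using induction_dual with
      | dual u => simp only [Arrow.dual_append, List.append_assoc]
      | add x y hx hy => simp only [mul_add, hx, hy]
      | neg x hx => simp only [mul_neg, hx]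
      | zero => simp only [mul_zero]
    | add x y hx hy => simp only [mul_add, add_mul, hx, hy]
    | neg x hx => simp only [mul_neg, neg_mul, hx]
    | zero => simp only [mul_zero, zero_mul]
  | add x y hx hy => simp only [add_mul, hx, hy]
  | neg x hx => simp only [neg_mul, hx]
  | zero => simp only [zero_mul]

theorem one_mul' (f : ForDual I) : 1 * f = f := by
  induction f using induction_dual with
  | dual s => rw [← Arrow.dual_nil, Arrow.dual_append, List.nil_append]
  | add x y hx hy => rw [mul_add, hx, hy]
  | neg x hx => rw [mul_neg, hx]
  | zero => rw [mul_zero]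

theorem mul_one' (f : ForDual I) : f * 1 = f := by
  induction f using induction_dual with
  | dual s => rw [← Arrow.dual_nil, Arrow.dual_append, List.append_nil]
  | add x y hx hy => rw [add_mul, hx, hy]
  | neg x hx => rw [neg_mul, hx]
  | zero => rw [zero_mul]

/-- The ring structure of `F*(I)`. -/
noncomputable abbrev ring (I : Type*) [Fintype I] [DecidableEq I] : Ring (ForDual I) :=
  { nonUnitalNonAssocRing I,
    (inferInstance : AddCommGroup (ForDual I)) with
    one := 1
    mul_assoc := mul_assoc'
    one_mul := one_mul'
    mul_one := mul_one' }

end ForDual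

/-! ### Products of generators in rings -/

section Products

variable {A ι : Type*} [Ring A]

theorem list_prod_mem_span_pow (g : ι → A) (s : List ι) :
    (s.map g).prod ∈ Submodule.span ℤ (Set.range g) ^ s.length := by
  induction s with
  | nil => exact Submodule.one_le.1 (by simp)
  | cons e s ih =>
    rw [List.map_cons, List.prod_cons, List.length_cons, pow_succ']
    exact Submodule.mul_mem_mul (Submodule.subset_span ⟨e, rfl⟩) ih

theorem span_pow_eq_span_list_prod (g : ι → A) (n : ℕ) :
    Submodule.span ℤ (Set.range g) ^ n =
      Submodule.span ℤ {x | ∃ s : List ι, s.length = n ∧ (s.map g).prod = x} := by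
  refine le_antisymm ?_ (Submodule.span_le.2 ?_)
  · rw [Submodule.span_pow]
    refine Submodule.span_mono fun x hx => ?_
    obtain ⟨f, rfl⟩ := Set.mem_pow.1 hx
    choose k hk using fun i => (f i).2
    refine ⟨List.ofFn k, List.length_ofFn, ?_⟩
    rw [List.map_ofFn]
    congr 2
    exact funext hk
  · rintro _ ⟨s, rfl, rfl⟩
    exact list_prod_mem_span_pow g s

theorem span_list_prod_eq_top (g : ι → A) (hg : Subring.closure (Set.range g) = ⊤) :
    Submodule.span ℤ (Set.range fun s : List ι => (s.map g).prod) = ⊤ := by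
  refine Submodule.eq_top_iff'.2 fun x => ?_
  have hx : x ∈ Subring.closure (Set.range g) := by rw [hg]; trivial
  rw [Subring.mem_closure_iff, ← Submodule.span_int_eq_addSubgroupClosure,
    Submodule.mem_toAddSubgroup] at hx
  refine Submodule.span_mono ?_ hx
  intro x hx
  obtain ⟨l, hl, rfl⟩ := Submonoid.exists_list_of_mem_closure hx
  clear hx
  induction l with
  | nil => exact ⟨[], rfl⟩
  | cons y l ih =>
    obtain ⟨e, rfl⟩ := hl y (by simp)
    obtain ⟨s, hs⟩ := ih (fun z hz => hl z (by simp [hz]))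
    exact ⟨e :: s, by simpa using congrArg (g e * ·) hs⟩

end Products

/-! ### Products of generators of `M(I)` -/

namespace Arrow

section Omega

variable {I : Type*}

/-- The generator of `M(I)` given by an arrow. -/
noncomputable def omega (e : Arrow I) : OmegaAlg I := omegaGen e.1.1 e.1.2 e.2

theorem omega_eq (e : Arrow I) : omega e =
    RingQuot.mkAlgHom ℤ (OmegaRel I) (ExteriorAlgebra.ι ℤ (Finsupp.single e 1)) := rfl

theorem omega_mul_self (e : Arrow I) : omega e * omega e = 0 := by
  rw [omega_eq, ← map_mul, ExteriorAlgebra.ι_sq_zero, map_zero]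

theorem omega_mul_comm (e e' : Arrow I) : omega e * omega e' = -(omega e' * omega e) := by
  have := congrArg (RingQuot.mkAlgHom ℤ (OmegaRel I)) (ExteriorAlgebra.ι_add_mul_swap
    (R := ℤ) (Finsupp.single e (1 : ℤ)) (Finsupp.single e' 1))
  rw [map_add, map_mul, map_mul, map_zero] at this
  exact eq_neg_of_add_eq_zero_left this

/-- Equal arrows give a square of odd degree; different arrows with the same target give the fork
relation. -/
theorem omega_mul_eq_zero {e e' : Arrow I} (h : e.1.2 = e'.1.2) : omega e * omega e' = 0 := by
  by_cases he : e = e'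
  · rw [he, omega_mul_self]
  · obtain ⟨⟨i, k⟩, hik⟩ := e
    obtain ⟨⟨j, l⟩, hjl⟩ := e'
    obtain rfl : k = l := h
    have hij : i ≠ j := fun h => he (by simp [h])
    have := RingQuot.mkAlgHom_rel ℤ (OmegaRel.fork i j k hij hik hjl)
    rwa [map_mul, map_zero] at this

/-- The product of the generators given by a list of arrows. -/
noncomputable def omegaProd (s : List (Arrow I)) : OmegaAlg I := (s.map omega).prod

theorem omegaProd_append (s t : List (Arrow I)) :
    omegaProd (s ++ t) = omegaProd s * omegaProd t := by
  simp [omegaProd]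

theorem omegaProd_cons (e : Arrow I) (s : List (Arrow I)) :
    omegaProd (e :: s) = omega e * omegaProd s := by
  simp [omegaProd]

/-- The sign is left undetermined: only vanishing and spans matter below. -/
theorem omegaProd_perm {s t : List (Arrow I)} (h : s.Perm t) :
    omegaProd s = omegaProd t ∨ omegaProd s = -omegaProd t := by
  induction h with
  | nil => exact Or.inl rfl
  | cons e _ ih =>
    simp only [omegaProd_cons]
    rcases ih with ih | ih
    · exact Or.inl (by rw [ih])
    · exact Or.inr (by rw [ih, mul_neg])
  | swap e e' s =>
    right
    simp only [omegaProd_cons]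
    rw [← mul_assoc, omega_mul_comm, neg_mul, mul_assoc]
  | trans _ _ ih ih' =>
    rcases ih with ih | ih <;> rcases ih' with ih' | ih' <;> simp [ih, ih']

theorem omegaProd_eq_zero_of_perm {s t : List (Arrow I)} (h : s.Perm t) (ht : omegaProd t = 0) :
    omegaProd s = 0 := by
  rcases omegaProd_perm h with h | h <;> simp [h, ht]

theorem omegaProd_eq_zero_of_not_nodup {s : List (Arrow I)} (h : ¬ (targets s).Nodup) :
    omegaProd s = 0 := by
  induction s with
  | nil => simp [targets] at h
  | cons e s ih =>
    by_cases hs : (targets s).Nodup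
    · have he : e.1.2 ∈ targets s := by
        by_contra he
        exact h (List.nodup_cons.2 ⟨he, hs⟩)
      obtain ⟨e', he', hee'⟩ := mem_targets.1 he
      obtain ⟨a, b, rfl⟩ := List.append_of_mem he'
      refine omegaProd_eq_zero_of_perm (t := e :: e' :: (a ++ b)) ?_ ?_
      · exact List.Perm.cons _ List.perm_middle
      · rw [omegaProd_cons, omegaProd_cons, ← mul_assoc, omega_mul_eq_zero hee'.symm, zero_mul]
    · rw [omegaProd_cons, ih hs, mul_zero]

/-- Different targets mean unique predecessors, so the closed walk contains a simple cycle. Its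
arrows can be moved to the front, where the cycle relation applies. -/
theorem omegaProd_eq_zero_of_cycle {s : List (Arrow I)} (hs : (targets s).Nodup) {i : I}
    (hi : Relation.TransGen (Rel s) i i) : omegaProd s = 0 := by
  classical
  have hirr : ∀ i, ¬ Rel s i i := by
    rintro i ⟨e, -, he⟩
    exact e.2 (by rw [he])
  obtain ⟨n, c, hn, hc, hR⟩ := exists_simple_cycle (Rel.unique hs) hirr hi
  have hne : ∀ k, c k ≠ c (k + 1) := fun k hk => hirr (c k) (by
    have := hR k
    rwa [← hk] at this)
  let t : List (Arrow I) := List.ofFn fun k => ⟨(c k, c (k + 1)), hne k⟩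
  have ht : omegaProd t = 0 := by
    have := RingQuot.mkAlgHom_rel ℤ (OmegaRel.cycle n hn c hc hne)
    rw [map_zero, map_list_prod, List.map_ofFn] at this
    rw [omegaProd, List.map_ofFn]
    exact this
  have htn : t.Nodup := List.nodup_ofFn.2 fun a b hab =>
    hc (Prod.mk.inj (Subtype.mk.inj hab)).1
  have hts : t ⊆ s := by
    intro e he
    obtain ⟨k, rfl⟩ := List.mem_ofFn.1 he
    obtain ⟨e, he, h⟩ := hR k
    have : e = ⟨(c k, c (k + 1)), hne k⟩ := Subtype.ext h
    rwa [← this]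
  obtain ⟨t', ht', hsub⟩ := List.subperm_of_subset htn hts
  obtain ⟨r, hr⟩ := hsub.exists_perm_append
  exact omegaProd_eq_zero_of_perm (hr.trans (ht'.append_right r)) (by rw [omegaProd_append, ht, zero_mul])

/-! ### Products of generators span `M(I)` and its components. -/

theorem range_omega :
    Set.range (omega (I := I)) = {x | ∃ i j : I, ∃ h : i ≠ j, x = omegaGen i j h} := by
  ext x
  constructor
  · rintro ⟨e, rfl⟩
    exact ⟨_, _, e.2, rfl⟩
  · rintro ⟨i, j, h, rfl⟩
    exact ⟨⟨(i, j), h⟩, rfl⟩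

theorem degree_eq_span_pow (n : ℕ) :
    OmegaAlg.degree I n = Submodule.span ℤ (Set.range (omega (I := I))) ^ n := by
  rw [range_omega]
  rfl

theorem omegaProd_mem_degree (s : List (Arrow I)) :
    omegaProd s ∈ OmegaAlg.degree I s.length := by
  rw [degree_eq_span_pow]
  exact list_prod_mem_span_pow omega s

theorem degree_eq_span (n : ℕ) : OmegaAlg.degree I n =
    Submodule.span ℤ {x | ∃ s : List (Arrow I), s.length = n ∧ omegaProd s = x} := by
  rw [degree_eq_span_pow]
  exact span_pow_eq_span_list_prod omega n

theorem closure_range_omega : Subring.closure (Set.range (omega (I := I))) = ⊤ := by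
  refine (Subring.eq_top_iff' _).2 fun x => ?_
  obtain ⟨y, rfl⟩ := RingQuot.mkAlgHom_surjective ℤ (OmegaRel I) x
  induction y using ExteriorAlgebra.induction with
  | algebraMap r => rw [eq_intCast, map_intCast]; exact intCast_mem _ r
  | ι m =>
    induction m using Finsupp.induction_linear with
    | zero => rw [map_zero, map_zero]; exact zero_mem _
    | add a b ha hb => rw [map_add, map_add]; exact add_mem ha hb
    | single e r =>
      rw [← mul_one r, ← smul_eq_mul, ← Finsupp.smul_single, map_zsmul, map_zsmul]
      have he : omega e ∈ Subring.closure (Set.range (omega (I := I))) :=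
        Subring.subset_closure ⟨e, rfl⟩
      exact zsmul_mem he r
  | mul a b ha hb => rw [map_mul]; exact mul_mem ha hb
  | add a b ha hb => rw [map_add]; exact add_mem ha hb

theorem span_omegaProd : Submodule.span ℤ (Set.range (omegaProd (I := I))) = ⊤ :=
  span_list_prod_eq_top omega closure_range_omega

end Omega

end Arrow

section Monomials

variable {I : Type*} [Fintype I]

theorem forestMonomial_eq (F : RForest I) (l : List F.nodes) :
    forestMonomial F l = Arrow.omegaProd (F.arrows l) := by
  simp only [forestMonomial, Arrow.omegaProd, RForest.arrows, List.map_map]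
  rfl

/-- A product of generators vanishes if a target is repeated or if there is a cycle; otherwise its
arrows are the edges of a forest, up to order. -/
theorem span_forestMonomial {w : (F : RForest I) → List F.nodes}
    (hw : ∀ F, (w F).Nodup ∧ ∀ j, j ∈ w F) :
    Submodule.span ℤ (Set.range fun F => forestMonomial F (w F)) = ⊤ := by
  rw [eq_top_iff, ← Arrow.span_omegaProd, Submodule.span_le]
  rintro _ ⟨s, rfl⟩
  by_cases hs : (Arrow.targets s).Nodup
  · by_cases ha : ∀ i, ¬ Relation.TransGen (Arrow.Rel s) i i
    · obtain ⟨F, hF, -⟩ := Arrow.exists_forest hs ha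
      have hp : s.Perm (F.arrows (w F)) := by
        refine (List.perm_ext_iff_of_nodup hs.of_map
          (RForest.nodup_targets_arrows (hw F).1).of_map).2 fun e => ?_
        rw [RForest.mem_arrows (hw F).2, hF]
        refine ⟨fun he => ⟨e, he, rfl⟩, ?_⟩
        rintro ⟨e', he', h⟩
        rwa [← Subtype.ext (h : e'.1 = e.1)]
      have hm : Arrow.omegaProd (F.arrows (w F)) ∈
          Submodule.span ℤ (Set.range fun F => forestMonomial F (w F)) :=
        Submodule.subset_span ⟨F, forestMonomial_eq F (w F)⟩
      rcases Arrow.omegaProd_perm hp with h | h <;> rw [h]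
      · exact hm
      · exact neg_mem hm
    · push Not at ha
      obtain ⟨i, hi⟩ := ha
      rw [Arrow.omegaProd_eq_zero_of_cycle hs hi]
      exact zero_mem _
  · rw [Arrow.omegaProd_eq_zero_of_not_nodup hs]
    exact zero_mem _

end Monomials

/-! ### The morphism from `M(I)` to the dual algebra -/

section Morphism

variable {I : Type*} [Fintype I] [DecidableEq I]

attribute [local instance] ForDual.ring

theorem Arrow.prod_dual (s : List (Arrow I)) :
    (s.map fun e => Arrow.dual [e]).prod = Arrow.dual s := by
  induction s with
  | nil => exact Arrow.dual_nil.symm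
  | cons e s ih => rw [List.map_cons, List.prod_cons, ih, Arrow.dual_append, List.singleton_append]

theorem Arrow.dual_mul_add (e e' : Arrow I) :
    Arrow.dual [e] * Arrow.dual [e'] + Arrow.dual [e'] * Arrow.dual [e] = 0 := by
  rw [Arrow.dual_append, Arrow.dual_append]
  exact Arrow.dual_pair_add e e'

theorem Arrow.dual_mul_self (e : Arrow I) : Arrow.dual [e] * Arrow.dual [e] = 0 := by
  rw [Arrow.dual_append]
  exact Arrow.dual_eq_zero_of_not_nodup (by simp [Arrow.targets])

/-- The linear map which takes the generator of an arrow to its dual form. -/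
noncomputable def dualLinear (I : Type*) [Fintype I] [DecidableEq I] :
    (Arrow I →₀ ℤ) →ₗ[ℤ] ForDual I :=
  Finsupp.linearCombination ℤ fun e => Arrow.dual [e]

theorem dualLinear_single (e : Arrow I) (r : ℤ) :
    dualLinear I (Finsupp.single e r) = r • Arrow.dual [e] :=
  Finsupp.linearCombination_single ℤ r e

theorem dualLinear_mul_add (x y : Arrow I →₀ ℤ) :
    dualLinear I x * dualLinear I y + dualLinear I y * dualLinear I x = 0 := by
  induction x using Finsupp.induction_linear with
  | zero => simp
  | add a b ha hb =>
    rw [map_add, add_mul, mul_add, add_add_add_comm, ha, hb, add_zero]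
  | single e r =>
    induction y using Finsupp.induction_linear with
    | zero => simp
    | add a b ha hb =>
      rw [map_add, add_mul, mul_add, add_add_add_comm, ha, hb, add_zero]
    | single e' r' =>
      rw [dualLinear_single, dualLinear_single, smul_mul_smul_comm, smul_mul_smul_comm,
        mul_comm r' r, ← smul_add, Arrow.dual_mul_add, smul_zero]

/-- The universal property of the exterior algebra requires every square to vanish, not only those
of generators: cross terms cancel by anticommutation. -/
theorem dualLinear_mul_self (x : Arrow I →₀ ℤ) : dualLinear I x * dualLinear I x = 0 := by
  induction x using Finsupp.induction_linear with
  | zero => simp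
  | add a b ha hb =>
    rw [map_add, add_mul, mul_add, mul_add, ha, hb, zero_add, add_zero, dualLinear_mul_add]
  | single e r =>
    rw [dualLinear_single, smul_mul_smul_comm, Arrow.dual_mul_self, smul_zero]

/-- The extension of `dualLinear` to the free graded-commutative algebra. -/
noncomputable def freeToDual (I : Type*) [Fintype I] [DecidableEq I] :
    FreeOmega I →ₐ[ℤ] ForDual I :=
  ExteriorAlgebra.lift ℤ ⟨dualLinear I, dualLinear_mul_self⟩

theorem freeToDual_freeOmega (i j : I) (h : i ≠ j) :
    freeToDual I (freeOmega i j h) = Arrow.dual [⟨(i, j), h⟩] := by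
  rw [freeToDual, freeOmega, ExteriorAlgebra.lift_ι_apply, dualLinear_single, one_smul]

omit [DecidableEq I] in
-- Following the ascents once around the cycle gives `c 0 ≤ c n ≤ c 0`, although `c n` and `c 0`
-- differ.
theorem not_compatible_cycle {n : ℕ} (c : Fin (n + 1) → I)
    (hc : ∀ k, c k ≠ c (k + 1)) (F : RForest I) :
    ¬ Arrow.Compatible (List.ofFn fun k => (⟨(c k, c (k + 1)), hc k⟩ : Arrow I)) F := by
  intro h
  have hle : ∀ k, F.Le (c k) (c (k + 1)) := fun k => h.le _ (List.mem_ofFn.2 ⟨k, rfl⟩)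
  have key : ∀ k (hk : k < n + 1), F.Le (c 0) (c ⟨k, hk⟩) := by
    intro k
    induction k with
    | zero => exact fun _ => RForest.Le.refl F _
    | succ k ih =>
      intro hk
      have h1 : (⟨k, by omega⟩ + 1 : Fin (n + 1)) = ⟨k + 1, hk⟩ :=
        Fin.ext (Fin.val_add_one_of_lt (by rw [Fin.lt_def]; simpa using hk))
      exact h1 ▸ (ih (by omega)).trans (hle ⟨k, by omega⟩)
  have h0 : F.Le (c (Fin.last n)) (c 0) := by
    have := hle (Fin.last n)
    rwa [Fin.last_add_one] at this
  have := hc (Fin.last n)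
  rw [Fin.last_add_one] at this
  exact this (h0.antisymm (key n (by omega)))

theorem freeToDual_rel {x y : FreeOmega I} (h : OmegaRel I x y) :
    freeToDual I x = freeToDual I y := by
  cases h with
  | fork i j k hij hik hjk =>
    rw [map_mul, map_zero, freeToDual_freeOmega, freeToDual_freeOmega, Arrow.dual_append]
    exact Arrow.dual_eq_zero_of_not_nodup (by simp [Arrow.targets])
  | cycle n hn c hc hne =>
    rw [map_zero, map_list_prod, List.map_ofFn]
    have : (freeToDual I ∘ fun k => freeOmega (c k) (c (k + 1)) (hne k)) =
        (fun e => Arrow.dual [e]) ∘ fun k => ⟨(c k, c (k + 1)), hne k⟩ :=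
      funext fun k => freeToDual_freeOmega _ _ _
    rw [this, ← List.map_ofFn, Arrow.prod_dual]
    exact Arrow.dual_eq_zero (not_compatible_cycle c hne)

/-- The morphism from `M(I)` to the dual algebra of the forest coalgebra. -/
noncomputable def omegaToDual (I : Type*) [Fintype I] [DecidableEq I] :
    OmegaAlg I →+* ForDual I :=
  (RingQuot.liftAlgHom ℤ ⟨freeToDual I, fun _ _ => freeToDual_rel⟩).toRingHom

theorem omegaToDual_omega (e : Arrow I) : omegaToDual I (Arrow.omega e) = Arrow.dual [e] := by
  refine (RingQuot.liftAlgHom_mkAlgHom_apply ℤ _ _ _).trans ?_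
  exact freeToDual_freeOmega _ _ e.2

theorem omegaToDual_omegaProd (s : List (Arrow I)) :
    omegaToDual I (Arrow.omegaProd s) = Arrow.dual s := by
  rw [Arrow.omegaProd, map_list_prod, List.map_map, ← Arrow.prod_dual]
  congr 2
  exact funext omegaToDual_omega

/-! ### The basis of forest monomials and bijectivity. -/

variable {w : (F : RForest I) → List F.nodes} (hw : ∀ F, (w F).Nodup ∧ ∀ j, j ∈ w F)
include hw

/-- Independence is inherited from the images, which are the unitriangular family of the dual. -/
theorem linearIndependent_forestMonomial :
    LinearIndependent ℤ fun F => forestMonomial F (w F) := by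
  refine LinearIndependent.of_comp (omegaToDual I).toAddMonoidHom.toIntLinearMap ?_
  convert ForDual.linearIndependent_dual_arrows hw using 1
  funext F
  exact (congrArg _ (forestMonomial_eq F (w F))).trans (omegaToDual_omegaProd _)

theorem exists_eq_sum_forestMonomial (x : OmegaAlg I) :
    ∃ c : RForest I → ℤ, ∑ F, c F • forestMonomial F (w F) = x := by
  have : x ∈ Submodule.span ℤ (Set.range fun F => forestMonomial F (w F)) := by
    rw [span_forestMonomial hw]
    trivial
  exact (Submodule.mem_span_range_iff_exists_fun ℤ).1 this

omit hw in
theorem omegaToDual_sum (c : RForest I → ℤ) :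
    omegaToDual I (∑ F, c F • forestMonomial F (w F)) =
      ∑ F, c F • Arrow.dual (F.arrows (w F)) := by
  rw [map_sum]
  exact Finset.sum_congr rfl fun F _ => by
    rw [map_zsmul, forestMonomial_eq, omegaToDual_omegaProd]

omit hw in
theorem omegaToDual_bijective : Function.Bijective (omegaToDual I) := by
  have hw : ∀ F : RForest I, (Finset.univ.toList : List F.nodes).Nodup ∧
    ∀ j, j ∈ (Finset.univ.toList : List F.nodes) :=
    fun F => ⟨Finset.nodup_toList _, fun j => by simp⟩
  constructor
  · rw [injective_iff_map_eq_zero]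
    intro x hx
    obtain ⟨c, rfl⟩ := exists_eq_sum_forestMonomial hw x
    rw [omegaToDual_sum] at hx
    have := Fintype.linearIndependent_iff.1 (ForDual.linearIndependent_dual_arrows hw) c hx
    simp [this]
  · intro f
    have : f ∈ Submodule.span ℤ
        (Set.range fun F : RForest I => Arrow.dual (F.arrows Finset.univ.toList)) := by
      rw [ForDual.span_dual_arrows hw]
      trivial
    obtain ⟨c, rfl⟩ := (Submodule.mem_span_range_iff_exists_fun ℤ).1 this
    exact ⟨_, omegaToDual_sum c⟩

end Morphism

/-! ### Degrees -/

section Degrees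

variable {I : Type*} [Fintype I] [DecidableEq I]

attribute [local instance] ForDual.ring

theorem Arrow.isHomogeneous_dual (s : List (Arrow I)) :
    (Arrow.dual s).IsHomogeneous s.length := fun _ ha =>
  Arrow.dual_apply_of_not fun h => ha (h.card_nodes.trans (List.length_map _))

theorem isHomogeneous_of_mem_degree {n : ℕ} {x : OmegaAlg I} (hx : x ∈ OmegaAlg.degree I n) :
    (omegaToDual I x).IsHomogeneous n := by
  rw [Arrow.degree_eq_span] at hx
  intro a ha
  induction hx using Submodule.span_induction with
  | mem x hx =>
    obtain ⟨s, rfl, rfl⟩ := hx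
    rw [omegaToDual_omegaProd]
    exact Arrow.isHomogeneous_dual s a ha
  | zero => rw [map_zero, ForDual.zero_apply]
  | add x y _ _ hx hy => rw [map_add, ForDual.add_apply, hx, hy, add_zero]
  | smul r x _ hx => rw [map_zsmul, ForDual.zsmul_apply, hx, mul_zero]

/-- Keep the terms of degree `n` in the expansion of `x`. Their sum has the same image as `x`: at
forests with `n` nodes the discarded terms vanish, at the others both sides vanish. Injectivity
concludes. -/
theorem mem_degree_of_isHomogeneous {n : ℕ} {x : OmegaAlg I}
    (hx : (omegaToDual I x).IsHomogeneous n) : x ∈ OmegaAlg.degree I n := by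
  let w : (F : RForest I) → List F.nodes := fun F => Finset.univ.toList
  have hw : ∀ F : RForest I, (w F).Nodup ∧ ∀ j, j ∈ w F :=
    fun F => ⟨Finset.nodup_toList _, fun j => by simp [w]⟩
  have hmem : ∀ F, forestMonomial F (w F) ∈ OmegaAlg.degree I F.nodes.card := by
    intro F
    have h := Arrow.omegaProd_mem_degree (F.arrows (w F))
    rw [← forestMonomial_eq] at h
    convert h using 2
    simp [RForest.arrows, w]
  obtain ⟨c, hc⟩ := exists_eq_sum_forestMonomial hw x
  have hy : ∑ F with F.nodes.card = n, c F • forestMonomial F (w F) ∈ OmegaAlg.degree I n :=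
    Submodule.sum_mem _ fun F hF =>
      Submodule.smul_mem _ _ ((Finset.mem_filter.1 hF).2 ▸ hmem F)
  have hyx : ∑ F with F.nodes.card = n, c F • forestMonomial F (w F) = x := by
    refine omegaToDual_bijective.1 (ForDual.ext_of fun F => ⟨F.orientation, rfl, ?_⟩)
    by_cases hF : F.nodes.card = n
    · rw [← hc, ← Finset.sum_filter_add_sum_filter_not Finset.univ
        (fun F : RForest I => F.nodes.card = n), map_add, ForDual.add_apply, left_eq_add,
        map_sum, ForDual.sum_apply]
      refine Finset.sum_eq_zero fun G hG => ?_
      rw [map_zsmul, ForDual.zsmul_apply,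
        isHomogeneous_of_mem_degree (hmem G) _ fun h => (Finset.mem_filter.1 hG).2 (h ▸ hF),
        mul_zero]
    · rw [isHomogeneous_of_mem_degree hy _ hF, hx _ hF]
  exact hyx ▸ hy

theorem omegaToDual_omegaGen (i j : I) (hij : i ≠ j) (k l : I) (hkl : k ≠ l) :
    omegaToDual I (omegaGen i j hij) (ForMod.of (orCherry k l hkl)) =
      if i = k ∧ j = l then 1 else 0 := by
  have h1 : omegaToDual I (omegaGen i j hij) = Arrow.dual [⟨(i, j), hij⟩] :=
    omegaToDual_omega ⟨(i, j), hij⟩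
  have hedge : ∀ a b, (RForest.cherry k l hkl).Edge a b ↔ a = k ∧ b = l := by
    intro a b
    simp only [RForest.Edge, RForest.cherry]
    split_ifs with h <;> simp [h, eq_comm]
  rw [h1]
  split_ifs with h
  · obtain ⟨rfl, rfl⟩ := h
    refine Arrow.dual_apply_eq_one ⟨List.nodup_singleton _, fun b => ?_, fun e he => ?_⟩ rfl
    · exact List.mem_singleton.trans (RForest.mem_nodes_cherry hkl b).symm
    · rw [List.mem_singleton.1 he]
      exact ((hedge i j).2 ⟨rfl, rfl⟩).le
  · refine Arrow.dual_apply_of_not fun hc => h ?_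
    -- The root `k` has no proper ancestor, so the only strict ascent in this forest is its edge.
    have hij' := hc.le ⟨(i, j), hij⟩ (List.mem_singleton_self _)
    obtain ⟨a, ha, hia⟩ := hij'.eq_or_edge.resolve_left hij
    obtain ⟨rfl, rfl⟩ := (hedge _ _).1 ha
    refine ⟨hia.eq_of_root (RForest.parent_eq_none_iff.2 fun hk => ?_), rfl⟩
    exact hkl ((RForest.mem_nodes_cherry hkl a).1 hk)

/-- The isomorphism from `M(I)` to the dual algebra of the forest coalgebra. -/
noncomputable def omegaEquivDual (I : Type*) [Fintype I] [DecidableEq I] :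
    OmegaAlg I ≃+* ForDual I :=
  RingEquiv.ofBijective (omegaToDual I) omegaToDual_bijective

theorem omegaEquivDual_one : omegaEquivDual I 1 = 1 := map_one (omegaToDual I)

end Degrees

theorem mainTheorem2 (I : Type*) [Fintype I] [DecidableEq I] :
    (∃ ρ : OmegaAlg I ≃+* ForDual I,
      ρ 1 = 1 ∧
      (∀ (n : ℕ) (x : OmegaAlg I), x ∈ OmegaAlg.degree I n ↔ (ρ x).IsHomogeneous n) ∧
      (∀ (i j : I) (hij : i ≠ j) (k l : I) (hkl : k ≠ l),
        ρ (omegaGen i j hij) (ForMod.of (orCherry k l hkl)) = if i = k ∧ j = l then 1 else 0)) ∧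
    (∀ w : (F : RForest I) → List F.nodes, (∀ F, (w F).Nodup ∧ ∀ j, j ∈ w F) →
      LinearIndependent ℤ (fun F => forestMonomial F (w F)) ∧
      Submodule.span ℤ (Set.range fun F => forestMonomial F (w F)) = ⊤) :=
  ⟨⟨omegaEquivDual I, omegaEquivDual_one,
    fun _ _ => ⟨isHomogeneous_of_mem_degree, mem_degree_of_isHomogeneous⟩, omegaToDual_omegaGen⟩,
    fun _ hw => ⟨linearIndependent_forestMonomial hw, span_forestMonomial hw⟩⟩
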